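/- **Conservativity of D.LRC over the Hilbert system of the Logic of Resources and Capabilities.** *Language.* Fix disjoint sets of atomic propositions $p$ and atomic resources $a$. Resource terms and formulas are $$\alpha ::= a\mid 1\mid 0\mid \alpha\cdot\alpha\mid\alpha\sqcup\alpha\mid\alpha\sqcap\alpha,\qquad A ::= p\mid\top\mid\bot\mid A\vee A\mid A\wedge A\mid A\to A\mid \alpha\rhd A\mid\Diamond A\mid\Diamond_r\alpha\mid\alpha\rhd_r\alpha .$$ *Hilbert system H.LRC.* Resource entailment $\alpha\vdash\beta$ is the least preorder, closed under uniform substitution, for which $\sqcup,\sqcap$ are join and meet of a distributive lattice with bottom $0$ and top $1$; $\cdot$ is associative with unit $1$; $\alpha\cdot(\beta\sqcup\gamma)\vdash(\alpha\cdot\beta)\sqcup(\alpha\cdot\gamma)$ and $(\beta\sqcup\gamma)\cdot\alpha\vdash(\beta\cdot\alpha)\sqcup(\gamma\cdot\alpha)$; and $\alpha\vdash\beta$ implies $\alpha\cdot\gamma\vdash\beta\cdot\gamma$ and $\gamma\cdot\alpha\vdash\gamma\cdot\beta$. The theorems are the least set of formulas containing the axioms of intuitionistic propositional logic and all instances of $\Diamond(A\vee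 B)\leftrightarrow\Diamond A\vee\Diamond B$; $\Diamond\bot\leftrightarrow\bot$; $\Diamond_r(\alpha\sqcup\beta)\leftrightarrow\Diamond_r\alpha\vee\Diamond_r\beta$; $\Diamond_r0\leftrightarrow\bot$; $(\alpha\sqcup\beta)\rhd A\leftrightarrow(\alpha\rhd A)\wedge(\beta\rhd A)$; $0\rhd A$; $\alpha\rhd(\beta\rhd A)\to(\alpha\cdot\beta)\rhd A$; $(\alpha\sqcup\beta)\rhd_r\gamma\leftrightarrow(\alpha\rhd_r\gamma)\wedge(\beta\rhd_r\gamma)$; $0\rhd_r\alpha$; $\alpha\rhd_r(\beta\sqcap\gamma)\leftrightarrow(\alpha\rhd_r\beta)\wedge(\alpha\rhd_r\gamma)$; $\alpha\rhd_r1$; $\Diamond_r\alpha\wedge(\alpha\rhd A)\to\Diamond A$; $\alpha\rhd_r\beta\to\alpha\rhd\Diamond_r\beta$; and closed under modus ponens, uniform substitution and the rules: from $A\to B$ infer $(\alpha\rhd A)\to(\alpha\rhd B)$ and $\Diamond A\to\Diamond B$; from $\alpha\vdash\beta$ infer $(\gamma\rhd_r\alpha)\to(\gamma\rhd_r\beta)$,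 $(\beta\rhd A)\to(\alpha\rhd A)$, $\Diamond_r\alpha\to\Diamond_r\beta$ and $(\beta\rhd_r\gamma)\to(\alpha\rhd_r\gamma)$. Write $A\vdash_{\mathrm{LRC}}B$ if $B$ is obtained from $A$ and theorems by modus ponens. *The calculus D.LRC.* Structures come in two types: $$X ::= A\mid \mathrm I\mid X;X\mid X>X\mid X<X\mid \circ X\mid\circ_r\Gamma\mid\Gamma\mathbin{\hat\rhd}X\mid\Gamma\mathbin{\hat\rhd_r}\Gamma\mid\bullet X,$$ $$\Gamma ::= \alpha\mid\Phi\mid\Gamma\odot\Gamma\mid\Gamma,\Gamma\mid\Gamma\gtrdot\Gamma\mid\Gamma\lessdot\Gamma\mid\Gamma\sqsupset\Gamma\mid\Gamma\sqsubset\Gamma\mid\bullet_rX\mid X\blacktriangleright X\mid X\blacktriangleright_r\Gamma\mid\Gamma\blacktriangle X .$$ Sequents are $X\vdash Y$ or $\Gamma\vdash\Delta$. A substructure is in succedent position if it is so by inheritance from the right-hand (succedent) or left-hand (precedent) root, the position being reversed exactly at the first coordinates of $>,\gtrdot,\sqsupset,\hat\rhd,\hat\rhd_r,\blacktriangleright,\blacktriangleright_r$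 and at the second coordinates of $<,\lessdot,\sqsubset$. The rules are ($/$ separates premises from conclusion, $/\!/$ marks two-way rules): - Identity and cut: $p\vdash p$; $a\vdash a$; $\Gamma\vdash\alpha$, $\alpha\vdash\Delta$ / $\Gamma\vdash\Delta$; and from $X\vdash Y$ with an occurrence of the formula $A$ in succedent position and $A\vdash Z$, infer the result of replacing that occurrence by $Z$. - Display rules: $X;Y\vdash Z$ // $Y\vdash X>Z$; $X;Y\vdash Z$ // $X\vdash Z<Y$; $Z\vdash X;Y$ // $X>Z\vdash Y$; $Z\vdash X;Y$ // $Z<Y\vdash X$; the same with $(\,,\,)$, $\sqsupset$, $\sqsubset$ for $;$, $>$, $<$; $\Gamma\odot\Delta\vdash\Theta$ // $\Delta\vdash\Gamma\gtrdot\Theta$; $\Gamma\odot\Delta\vdash\Theta$ // $\Gamma\vdash\Theta\lessdot\Delta$; $\circ X\vdash Y$ // $X\vdash\bullet Y$; $\circ_r\Gamma\vdash X$ // $\Gamma\vdash\bullet_rX$; $X\vdash\Gamma\mathbin{\hat\rhd}Y$ // $\Gamma\vdash X\blacktriangleright Y$; $X\vdash\Gamma\mathbin{\hat\rhd_r}\Delta$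 // $\Gamma\blacktriangle X\vdash\Delta$; $X\vdash\Gamma\mathbin{\hat\rhd_r}\Delta$ // $\Gamma\vdash X\blacktriangleright_r\Delta$. - Structural rules: exchange, weakening, contraction, (two-way) associativity of $;$ and of the comma on both sides; $X\vdash Y$ // $\mathrm I;X\vdash Y$; $Y\vdash X$ // $Y\vdash X;\mathrm I$; $\Gamma\vdash\Delta$ // $\Gamma\odot\Phi\vdash\Delta$; $\Gamma\vdash\Delta$ // $\Phi\odot\Gamma\vdash\Delta$; $\Gamma\vdash\Delta$ // $\Gamma\vdash\Delta,\Phi$; two-way associativity of $\odot$ on the left; $\Phi\vdash\Delta$ / $\Gamma\vdash\Delta$; $\Xi\vdash(\Gamma\gtrdot\Delta),(\Gamma\gtrdot\Theta)$ / $\Xi\vdash\Gamma\gtrdot(\Delta,\Theta)$; $X\vdash\bullet Y;\bullet Z$ / $X\vdash\bullet(Y;Z)$; $\Gamma\vdash\bullet_rX,\bullet_rY$ / $\Gamma\vdash\bullet_r(X;Y)$; $X\vdash\mathrm I$ / $X\vdash\bullet\mathrm I$; $\Gamma\vdash\Phi$ / $\Gamma\vdash\bullet_r\mathrm I$; $\Gamma\vdash(Y\blacktriangleright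 W),(Z\blacktriangleright W)$ / $\Gamma\vdash(Y;Z)\blacktriangleright W$; $\Gamma\vdash(Y\blacktriangleright_r\Delta),(Z\blacktriangleright_r\Delta)$ / $\Gamma\vdash(Y;Z)\blacktriangleright_r\Delta$; $(\Gamma\blacktriangle X),(\Gamma\blacktriangle Y)\vdash\Delta$ / $\Gamma\blacktriangle(X;Y)\vdash\Delta$; $X\vdash\Gamma\mathbin{\hat\rhd}(\Delta\mathbin{\hat\rhd}Y)$ / $X\vdash(\Gamma\odot\Delta)\mathbin{\hat\rhd}Y$; $\Phi\vdash\Delta$ / $\Gamma\blacktriangle\mathrm I\vdash\Delta$; $X\vdash\Gamma\mathbin{\hat\rhd}\bullet Y$ / $X\vdash\circ_r\Gamma>Y$; $X\vdash\Gamma\mathbin{\hat\rhd_r}\bullet_rY$ / $X\vdash\Gamma\mathbin{\hat\rhd}Y$. - Introduction rules: $\bot\vdash\mathrm I$; $X\vdash\mathrm I$ / $X\vdash\bot$; $\mathrm I\vdash X$ / $\top\vdash X$; $\mathrm I\vdash\top$; $A;B\vdash X$ / $A\wedge B\vdash X$; $X\vdash A$, $Y\vdash B$ / $X;Y\vdash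 A\wedge B$; $A\vdash X$, $B\vdash Y$ / $A\vee B\vdash X;Y$; $X\vdash A;B$ / $X\vdash A\vee B$; $X\vdash A$, $B\vdash Y$ / $A\to B\vdash X>Y$; $X\vdash A>B$ / $X\vdash A\to B$; the analogous rules for $0,1,\sqcap,\sqcup$ with $\Phi$ and the comma for $\mathrm I$ and $;$; $\alpha\odot\beta\vdash\Gamma$ / $\alpha\cdot\beta\vdash\Gamma$; $\Gamma\vdash\alpha$, $\Delta\vdash\beta$ / $\Gamma\odot\Delta\vdash\alpha\cdot\beta$; $\circ A\vdash X$ / $\Diamond A\vdash X$; $X\vdash A$ / $\circ X\vdash\Diamond A$; $\circ_r\alpha\vdash X$ / $\Diamond_r\alpha\vdash X$; $\Gamma\vdash\alpha$ / $\circ_r\Gamma\vdash\Diamond_r\alpha$; $\Gamma\vdash\alpha$, $A\vdash X$ / $\alpha\rhd A\vdash\Gamma\mathbin{\hat\rhd}X$; $X\vdash\alpha\mathbin{\hat\rhd}A$ / $X\vdash\alpha\rhd A$; $\Gamma\vdash\alpha$, $\beta\vdash\Delta$ / $\alpha\rhd_r\beta\vdash\Gamma\mathbin{\hat\rhd_r}\Delta$;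 $X\vdash\alpha\mathbin{\hat\rhd_r}\beta$ / $X\vdash\alpha\rhd_r\beta$. **Theorem.** For all formulas $A$ and $B$: if the sequent $A\vdash B$ is derivable in D.LRC, then $A\vdash_{\mathrm{LRC}}B$. -/

import Mathlib

universe u v

namespace LRC

/-- Resource-terms over the atomic resources `AtRes`:
`α ::= a | 1 | 0 | α · α | α ⊔ α | α ⊓ α`. -/
inductive ResTerm (AtRes : Type v) : Type v
  | atom (a : AtRes) : ResTerm AtRes
  | one : ResTerm AtRes
  | zero : ResTerm AtRes
  | dot (α β : ResTerm AtRes) : ResTerm AtRes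
  | join (α β : ResTerm AtRes) : ResTerm AtRes
  | meet (α β : ResTerm AtRes) : ResTerm AtRes

/-- Formula-terms over the atomic propositions `AtProp` and the resource-terms:
`A ::= p | ⊤ | ⊥ | A ∨ A | A ∧ A | A → A | α ▷ A | ◇ A | ◇ᵣ α | α ▷ᵣ α`.
Here `◇ A` is `able A` (the agent is able to bring about `A`),
`◇ᵣ α` is `has α` (the agent possesses `α`),
`α ▷ A` is `bring α A` (the agent can bring about `A` using `α`),
`α ▷ᵣ β` is `get α β` (the agent can get `β` from `α`). -/
inductive Formula (AtProp : Type u) (AtRes : Type v) : Type (max u v)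
  | atom (p : AtProp) : Formula AtProp AtRes
  | top : Formula AtProp AtRes
  | bot : Formula AtProp AtRes
  | or (A B : Formula AtProp AtRes) : Formula AtProp AtRes
  | and (A B : Formula AtProp AtRes) : Formula AtProp AtRes
  | imp (A B : Formula AtProp AtRes) : Formula AtProp AtRes
  | bring (α : ResTerm AtRes) (A : Formula AtProp AtRes) : Formula AtProp AtRes
  | able (A : Formula AtProp AtRes) : Formula AtProp AtRes
  | has (α : ResTerm AtRes) : Formula AtProp AtRes
  | get (α β : ResTerm AtRes) : Formula AtProp AtRes

/-- Uniform substitution in resource-terms. -/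
def ResTerm.subst {AtRes : Type v} (ρ : AtRes → ResTerm AtRes) : ResTerm AtRes → ResTerm AtRes
  | .atom a => ρ a
  | .one => .one
  | .zero => .zero
  | .dot α β => .dot (α.subst ρ) (β.subst ρ)
  | .join α β => .join (α.subst ρ) (β.subst ρ)
  | .meet α β => .meet (α.subst ρ) (β.subst ρ)

namespace Formula

variable {AtProp : Type u} {AtRes : Type v}

/-- Uniform substitution in formulas. -/
def subst (σ : AtProp → Formula AtProp AtRes) (ρ : AtRes → ResTerm AtRes) :
    Formula AtProp AtRes → Formula AtProp AtRes
  | .atom p => σ p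
  | .top => .top
  | .bot => .bot
  | .or A B => .or (A.subst σ ρ) (B.subst σ ρ)
  | .and A B => .and (A.subst σ ρ) (B.subst σ ρ)
  | .imp A B => .imp (A.subst σ ρ) (B.subst σ ρ)
  | .bring α A => .bring (α.subst ρ) (A.subst σ ρ)
  | .able A => .able (A.subst σ ρ)
  | .has α => .has (α.subst ρ)
  | .get α β => .get (α.subst ρ) (β.subst ρ)

/-- `A ↔ B`. -/
def iff (A B : Formula AtProp AtRes) : Formula AtProp AtRes := .and (.imp A B) (.imp B A)

end Formula

/-! ### The Hilbert system H.LRC -/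

/-- Pure-resource entailment `α ⊢ β` of H.LRC: the least preorder on resource-terms for which
`⊔`, `⊓` are the join and meet of a distributive lattice with top `1` and bottom `0`
(commutativity, associativity and idempotence follow from the order rules),
`·` is associative with unit `1`, distributes over `⊔` on both sides,
and is monotone in both coordinates. -/
inductive ResEntails {AtRes : Type v} : ResTerm AtRes → ResTerm AtRes → Prop
  | refl (α) : ResEntails α α
  | trans {α β γ} : ResEntails α β → ResEntails β γ → ResEntails α γ
  -- lattice order
  | join_left (α β) : ResEntails α (.join α β)
  | join_right (α β) : ResEntails β (.join α β)
  | join_least {α β γ} : ResEntails α γ → ResEntails β γ → ResEntails (.join α β) γ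
  | meet_left (α β) : ResEntails (.meet α β) α
  | meet_right (α β) : ResEntails (.meet α β) β
  | meet_greatest {α β γ} : ResEntails γ α → ResEntails γ β → ResEntails γ (.meet α β)
  -- distributivity (the converse entailments hold in every lattice)
  | meet_join (α β γ) :
      ResEntails (.meet α (.join β γ)) (.join (.meet α β) (.meet α γ))
  | join_meet (α β γ) :
      ResEntails (.meet (.join α β) (.join α γ)) (.join α (.meet β γ))
  -- `·` is associative with unit `1`
  | dot_assoc (α β γ) : ResEntails (.dot α (.dot β γ)) (.dot (.dot α β) γ)
  | dot_assoc' (α β γ) : ResEntails (.dot (.dot α β) γ) (.dot α (.dot β γ))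
  | dot_one (α) : ResEntails (.dot α .one) α
  | dot_one' (α) : ResEntails α (.dot α .one)
  | one_dot (α) : ResEntails (.dot .one α) α
  | one_dot' (α) : ResEntails α (.dot .one α)
  -- `1` is top and `0` is bottom
  | le_one (α) : ResEntails α .one
  | zero_le (α) : ResEntails .zero α
  -- `·` distributes over `⊔`
  | dot_join (α β γ) :
      ResEntails (.dot α (.join β γ)) (.join (.dot α β) (.dot α γ))
  | join_dot (α β γ) :
      ResEntails (.dot (.join β γ) α) (.join (.dot β α) (.dot γ α))
  -- the rules MF and MF'
  | MF {α β} (γ) : ResEntails α β → ResEntails (.dot α γ) (.dot β γ)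
  | MF' {α β} (γ) : ResEntails α β → ResEntails (.dot γ α) (.dot γ β)
  | subst {α β} (ρ : AtRes → ResTerm AtRes) :
      ResEntails α β → ResEntails (α.subst ρ) (β.subst ρ)

open Formula in
/-- The theorems of H.LRC.  In the rules, an entailment `A ⊢ B` between formulas is
the theoremhood of `A → B`. -/
inductive HThm {AtProp : Type u} {AtRes : Type v} : Formula AtProp AtRes → Prop
  -- intuitionistic propositional logic
  | imp_k (A B) : HThm (imp A (imp B A))
  | imp_s (A B C) : HThm (imp (imp A (imp B C)) (imp (imp A B) (imp A C)))
  | and_left (A B) : HThm (imp (and A B) A)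
  | and_right (A B) : HThm (imp (and A B) B)
  | and_intro (A B) : HThm (imp A (imp B (and A B)))
  | or_left (A B) : HThm (imp A (or A B))
  | or_right (A B) : HThm (imp B (or A B))
  | or_elim (A B C) : HThm (imp (imp A C) (imp (imp B C) (imp (or A B) C)))
  | bot_elim (A) : HThm (imp bot A)
  | top_intro : HThm top
  | mp {A B} : HThm (imp A B) → HThm A → HThm B
  -- uniform substitution
  | subst {A} (σ : AtProp → Formula AtProp AtRes) (ρ : AtRes → ResTerm AtRes) :
      HThm A → HThm (A.subst σ ρ)
  -- axiom schemas for the diamonds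
  | D1 (A B) : HThm (iff (able (or A B)) (or (able A) (able B)))
  | D2 : HThm (iff (able bot) bot)
  | D3 (α β) : HThm (iff (has (.join α β)) (or (has α) (has β)))
  | D4 : HThm (iff (has .zero) bot)
  -- axiom schemas for the triangles
  | B1 (α β A) : HThm (iff (bring (.join α β) A) (and (bring α A) (bring β A)))
  | B2 (A) : HThm (bring .zero A)
  | B3 (α β A) : HThm (imp (bring α (bring β A)) (bring (.dot α β) A))
  | B4 (α β γ) : HThm (iff (get (.join α β) γ) (and (get α γ) (get β γ)))
  | B5 (α) : HThm (get .zero α)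
  | B6 (α β γ) : HThm (iff (get α (.meet β γ)) (and (get α β) (get α γ)))
  | B7 (α) : HThm (get α .one)
  -- interaction axiom schemas
  | BD1 (α A) : HThm (imp (and (has α) (bring α A)) (able A))
  | BD2 (α β) : HThm (imp (get α β) (bring α (has β)))
  -- rules
  | MB {A B} (α) : HThm (imp A B) → HThm (imp (bring α A) (bring α B))
  | MD {A B} : HThm (imp A B) → HThm (imp (able A) (able B))
  | MB' {α β} (γ) : ResEntails α β → HThm (imp (get γ α) (get γ β))
  | AB {α β} (A) : ResEntails α β → HThm (imp (bring β A) (bring α A))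
  | MD' {α β} : ResEntails α β → HThm (imp (has α) (has β))
  | AB' {α β} (γ) : ResEntails α β → HThm (imp (get β γ) (get α γ))

/-- `A ⊢_LRC B`: there is a proof of `B` from the theorems of H.LRC and the hypothesis `A`,
by modus ponens. -/
inductive HEntails {AtProp : Type u} {AtRes : Type v} (A : Formula AtProp AtRes) :
    Formula AtProp AtRes → Prop
  | hyp : HEntails A A
  | thm {B} : HThm B → HEntails A B
  | mp {B C} : HEntails A (.imp B C) → HEntails A B → HEntails A C

/-! ### The multi-type calculus D.LRC -/

/-- The two types of the language: formulas and resources. -/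
inductive Ty : Type
  | fm
  | res

/-- Structures of type `fm` and of type `res`. -/
inductive Str (AtProp : Type u) (AtRes : Type v) : Ty → Type (max u v)
  /-- a formula, as a structure -/
  | form (A : Formula AtProp AtRes) : Str AtProp AtRes .fm
  /-- `I`, read `⊤` on the left and `⊥` on the right -/
  | I : Str AtProp AtRes .fm
  /-- `X ; Y`, read `∧` on the left and `∨` on the right -/
  | semi (X Y : Str AtProp AtRes .fm) : Str AtProp AtRes .fm
  /-- `X > Y` -/
  | gt (X Y : Str AtProp AtRes .fm) : Str AtProp AtRes .fm
  /-- `X < Y` -/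
  | lt (X Y : Str AtProp AtRes .fm) : Str AtProp AtRes .fm
  /-- the structural connective of `◇ : Fm → Fm` -/
  | circ (X : Str AtProp AtRes .fm) : Str AtProp AtRes .fm
  /-- the structural connective of `◇ᵣ : Res → Fm` -/
  | circRes (Γ : Str AtProp AtRes .res) : Str AtProp AtRes .fm
  /-- the structural connective of `▷ : Res × Fm → Fm` -/
  | tri (Γ : Str AtProp AtRes .res) (X : Str AtProp AtRes .fm) : Str AtProp AtRes .fm
  /-- the structural connective of `▷ᵣ : Res × Res → Fm` -/
  | triRes (Γ Δ : Str AtProp AtRes .res) : Str AtProp AtRes .fm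
  /-- right adjoint of `circ` -/
  | bullet (X : Str AtProp AtRes .fm) : Str AtProp AtRes .fm
  /-- a resource-term, as a structure -/
  | rterm (α : ResTerm AtRes) : Str AtProp AtRes .res
  /-- `Φ`, read `1` on the left and `0` on the right -/
  | Phi : Str AtProp AtRes .res
  /-- `Γ ⊙ Δ`, the structural connective of `·` -/
  | odot (Γ Δ : Str AtProp AtRes .res) : Str AtProp AtRes .res
  /-- `Γ , Δ`, read `⊓` on the left and `⊔` on the right -/
  | comma (Γ Δ : Str AtProp AtRes .res) : Str AtProp AtRes .res
  /-- `Γ ⋗ Δ`, residual of `⊙` -/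
  | gtdot (Γ Δ : Str AtProp AtRes .res) : Str AtProp AtRes .res
  /-- `Γ ⋖ Δ`, residual of `⊙` -/
  | ltdot (Γ Δ : Str AtProp AtRes .res) : Str AtProp AtRes .res
  /-- `Γ ⊐ Δ`, residual of the comma -/
  | sqsup (Γ Δ : Str AtProp AtRes .res) : Str AtProp AtRes .res
  /-- `Γ ⊏ Δ`, residual of the comma -/
  | sqsub (Γ Δ : Str AtProp AtRes .res) : Str AtProp AtRes .res
  /-- right adjoint of `circRes` -/
  | bulletRes (X : Str AtProp AtRes .fm) : Str AtProp AtRes .res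
  /-- Galois adjoint of `tri` in its first coordinate -/
  | btri (X Y : Str AtProp AtRes .fm) : Str AtProp AtRes .res
  /-- Galois adjoint of `triRes` in its first coordinate -/
  | btriRes (X : Str AtProp AtRes .fm) (Δ : Str AtProp AtRes .res) : Str AtProp AtRes .res
  /-- left adjoint of `triRes` in its second coordinate -/
  | bup (Γ : Str AtProp AtRes .res) (X : Str AtProp AtRes .fm) : Str AtProp AtRes .res

/-- Precedent and succedent (consequent) position. -/
inductive Pos : Type
  | pre
  | suc

/-- The opposite position. -/
def Pos.flip : Pos → Pos
  | .pre => .suc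
  | .suc => .pre

/-- `SucRepl A Z s S S'`: if the root of the structure `S` has position `s`, then `S'` results
from `S` by replacing exactly one occurrence of the structure `A` in succedent position by `Z`.
The position is inherited by each coordinate of a structural connective, except that it is
reversed in the first coordinates of `>`, `⋗`, `⊐`, `tri`, `triRes`, `btri`, `btriRes`
and in the second coordinates of `<`, `⋖`, `⊏`. -/
inductive SucRepl {AtProp : Type u} {AtRes : Type v}
    (A : Formula AtProp AtRes) (Z : Str AtProp AtRes .fm) :
    Pos → {τ : Ty} → Str AtProp AtRes τ → Str AtProp AtRes τ → Prop
  | here : SucRepl A Z .suc (.form A) Z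
  | semi_l {s X X'} (Y) : SucRepl A Z s X X' → SucRepl A Z s (.semi X Y) (.semi X' Y)
  | semi_r {s Y Y'} (X) : SucRepl A Z s Y Y' → SucRepl A Z s (.semi X Y) (.semi X Y')
  | gt_l {s X X'} (Y) : SucRepl A Z s.flip X X' → SucRepl A Z s (.gt X Y) (.gt X' Y)
  | gt_r {s Y Y'} (X) : SucRepl A Z s Y Y' → SucRepl A Z s (.gt X Y) (.gt X Y')
  | lt_l {s X X'} (Y) : SucRepl A Z s X X' → SucRepl A Z s (.lt X Y) (.lt X' Y)
  | lt_r {s Y Y'} (X) : SucRepl A Z s.flip Y Y' → SucRepl A Z s (.lt X Y) (.lt X Y')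
  | circ {s X X'} : SucRepl A Z s X X' → SucRepl A Z s (.circ X) (.circ X')
  | circRes {s Γ Γ'} : SucRepl A Z s Γ Γ' → SucRepl A Z s (.circRes Γ) (.circRes Γ')
  | tri_l {s Γ Γ'} (X) : SucRepl A Z s.flip Γ Γ' → SucRepl A Z s (.tri Γ X) (.tri Γ' X)
  | tri_r {s X X'} (Γ) : SucRepl A Z s X X' → SucRepl A Z s (.tri Γ X) (.tri Γ X')
  | triRes_l {s Γ Γ'} (Δ) :
      SucRepl A Z s.flip Γ Γ' → SucRepl A Z s (.triRes Γ Δ) (.triRes Γ' Δ)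
  | triRes_r {s Δ Δ'} (Γ) : SucRepl A Z s Δ Δ' → SucRepl A Z s (.triRes Γ Δ) (.triRes Γ Δ')
  | bullet {s X X'} : SucRepl A Z s X X' → SucRepl A Z s (.bullet X) (.bullet X')
  | odot_l {s Γ Γ'} (Δ) : SucRepl A Z s Γ Γ' → SucRepl A Z s (.odot Γ Δ) (.odot Γ' Δ)
  | odot_r {s Δ Δ'} (Γ) : SucRepl A Z s Δ Δ' → SucRepl A Z s (.odot Γ Δ) (.odot Γ Δ')
  | comma_l {s Γ Γ'} (Δ) : SucRepl A Z s Γ Γ' → SucRepl A Z s (.comma Γ Δ) (.comma Γ' Δ)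
  | comma_r {s Δ Δ'} (Γ) : SucRepl A Z s Δ Δ' → SucRepl A Z s (.comma Γ Δ) (.comma Γ Δ')
  | gtdot_l {s Γ Γ'} (Δ) :
      SucRepl A Z s.flip Γ Γ' → SucRepl A Z s (.gtdot Γ Δ) (.gtdot Γ' Δ)
  | gtdot_r {s Δ Δ'} (Γ) : SucRepl A Z s Δ Δ' → SucRepl A Z s (.gtdot Γ Δ) (.gtdot Γ Δ')
  | ltdot_l {s Γ Γ'} (Δ) : SucRepl A Z s Γ Γ' → SucRepl A Z s (.ltdot Γ Δ) (.ltdot Γ' Δ)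
  | ltdot_r {s Δ Δ'} (Γ) :
      SucRepl A Z s.flip Δ Δ' → SucRepl A Z s (.ltdot Γ Δ) (.ltdot Γ Δ')
  | sqsup_l {s Γ Γ'} (Δ) :
      SucRepl A Z s.flip Γ Γ' → SucRepl A Z s (.sqsup Γ Δ) (.sqsup Γ' Δ)
  | sqsup_r {s Δ Δ'} (Γ) : SucRepl A Z s Δ Δ' → SucRepl A Z s (.sqsup Γ Δ) (.sqsup Γ Δ')
  | sqsub_l {s Γ Γ'} (Δ) : SucRepl A Z s Γ Γ' → SucRepl A Z s (.sqsub Γ Δ) (.sqsub Γ' Δ)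
  | sqsub_r {s Δ Δ'} (Γ) :
      SucRepl A Z s.flip Δ Δ' → SucRepl A Z s (.sqsub Γ Δ) (.sqsub Γ Δ')
  | bulletRes {s X X'} : SucRepl A Z s X X' → SucRepl A Z s (.bulletRes X) (.bulletRes X')
  | btri_l {s X X'} (Y) : SucRepl A Z s.flip X X' → SucRepl A Z s (.btri X Y) (.btri X' Y)
  | btri_r {s Y Y'} (X) : SucRepl A Z s Y Y' → SucRepl A Z s (.btri X Y) (.btri X Y')
  | btriRes_l {s X X'} (Δ) :
      SucRepl A Z s.flip X X' → SucRepl A Z s (.btriRes X Δ) (.btriRes X' Δ)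
  | btriRes_r {s Δ Δ'} (X) : SucRepl A Z s Δ Δ' → SucRepl A Z s (.btriRes X Δ) (.btriRes X Δ')
  | bup_l {s Γ Γ'} (X) : SucRepl A Z s Γ Γ' → SucRepl A Z s (.bup Γ X) (.bup Γ' X)
  | bup_r {s X X'} (Γ) : SucRepl A Z s X X' → SucRepl A Z s (.bup Γ X) (.bup Γ X')

open Str in
/-- Derivability of sequents in D.LRC.  A sequent relates two structures of the same type.
A rule that can be read in both directions (double line) is given by two constructors,
the second one primed. -/
inductive DLRC {AtProp : Type u} {AtRes : Type v} :
    {τ : Ty} → Str AtProp AtRes τ → Str AtProp AtRes τ → Prop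
  -- identity
  | id_prop (p : AtProp) : DLRC (form (.atom p)) (form (.atom p))
  | id_res (a : AtRes) : DLRC (rterm (.atom a)) (rterm (.atom a))
  -- surgical cut on formulas: the cut formula occurs in succedent position anywhere in `X ⊢ Y`
  | cut_fm_l {X X' Y Z A} :
      DLRC X Y → SucRepl A Z .pre X X' → DLRC (form A) Z → DLRC X' Y
  | cut_fm_r {X Y Y' Z A} :
      DLRC X Y → SucRepl A Z .suc Y Y' → DLRC (form A) Z → DLRC X Y'
  -- cut on resources
  | cut_res {Γ Δ α} : DLRC Γ (rterm α) → DLRC (rterm α) Δ → DLRC Γ Δ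
  -- display postulates, pure formula connectives
  | semi_gt {X Y Z} : DLRC (semi X Y) Z → DLRC Y (gt X Z)
  | semi_gt' {X Y Z} : DLRC Y (gt X Z) → DLRC (semi X Y) Z
  | gt_semi {X Y Z} : DLRC Z (semi X Y) → DLRC (gt X Z) Y
  | gt_semi' {X Y Z} : DLRC (gt X Z) Y → DLRC Z (semi X Y)
  | semi_lt {X Y Z} : DLRC (semi X Y) Z → DLRC X (lt Z Y)
  | semi_lt' {X Y Z} : DLRC X (lt Z Y) → DLRC (semi X Y) Z
  | lt_semi {X Y Z} : DLRC Z (semi X Y) → DLRC (lt Z Y) X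
  | lt_semi' {X Y Z} : DLRC (lt Z Y) X → DLRC Z (semi X Y)
  -- display postulates, pure resource connectives
  | comma_sqsup {Γ Δ Θ} : DLRC (comma Γ Δ) Θ → DLRC Δ (sqsup Γ Θ)
  | comma_sqsup' {Γ Δ Θ} : DLRC Δ (sqsup Γ Θ) → DLRC (comma Γ Δ) Θ
  | comma_sqsub {Γ Δ Θ} : DLRC (comma Γ Δ) Θ → DLRC Γ (sqsub Θ Δ)
  | comma_sqsub' {Γ Δ Θ} : DLRC Γ (sqsub Θ Δ) → DLRC (comma Γ Δ) Θ
  | sqsup_comma {Γ Δ Θ} : DLRC Γ (comma Δ Θ) → DLRC (sqsup Δ Γ) Θ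
  | sqsup_comma' {Γ Δ Θ} : DLRC (sqsup Δ Γ) Θ → DLRC Γ (comma Δ Θ)
  | sqsub_comma {Γ Δ Θ} : DLRC Γ (comma Δ Θ) → DLRC (sqsub Γ Θ) Δ
  | sqsub_comma' {Γ Δ Θ} : DLRC (sqsub Γ Θ) Δ → DLRC Γ (comma Δ Θ)
  | odot_gtdot {Γ Δ Θ} : DLRC (odot Γ Δ) Θ → DLRC Δ (gtdot Γ Θ)
  | odot_gtdot' {Γ Δ Θ} : DLRC Δ (gtdot Γ Θ) → DLRC (odot Γ Δ) Θ
  | odot_ltdot {Γ Δ Θ} : DLRC (odot Γ Δ) Θ → DLRC Γ (ltdot Θ Δ)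
  | odot_ltdot' {Γ Δ Θ} : DLRC Γ (ltdot Θ Δ) → DLRC (odot Γ Δ) Θ
  -- display postulates, modal operators
  | circ_bullet {X Y} : DLRC (circ X) Y → DLRC X (bullet Y)
  | circ_bullet' {X Y} : DLRC X (bullet Y) → DLRC (circ X) Y
  | circRes_bulletRes {Γ X} : DLRC (circRes Γ) X → DLRC Γ (bulletRes X)
  | circRes_bulletRes' {Γ X} : DLRC Γ (bulletRes X) → DLRC (circRes Γ) X
  | tri_btri {X Γ Y} : DLRC X (tri Γ Y) → DLRC Γ (btri X Y)
  | tri_btri' {X Γ Y} : DLRC Γ (btri X Y) → DLRC X (tri Γ Y)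
  | triRes_bup {X Γ Δ} : DLRC X (triRes Γ Δ) → DLRC (bup Γ X) Δ
  | triRes_bup' {X Γ Δ} : DLRC (bup Γ X) Δ → DLRC X (triRes Γ Δ)
  | triRes_btriRes {X Γ Δ} : DLRC X (triRes Γ Δ) → DLRC Γ (btriRes X Δ)
  | triRes_btriRes' {X Γ Δ} : DLRC Γ (btriRes X Δ) → DLRC X (triRes Γ Δ)
  -- structural rules, pure formula type
  | I_L {X Y} : DLRC X Y → DLRC (semi I X) Y
  | I_L' {X Y} : DLRC (semi I X) Y → DLRC X Y
  | I_R {X Y} : DLRC Y X → DLRC Y (semi X I)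
  | I_R' {X Y} : DLRC Y (semi X I) → DLRC Y X
  | E_L {X Y Z} : DLRC (semi Y X) Z → DLRC (semi X Y) Z
  | E_R {X Y Z} : DLRC Z (semi X Y) → DLRC Z (semi Y X)
  | W_L {X Y Z} : DLRC Y Z → DLRC (semi X Y) Z
  | W_R {X Y Z} : DLRC Z Y → DLRC Z (semi Y X)
  | C_L {X Y} : DLRC (semi X X) Y → DLRC X Y
  | C_R {X Y} : DLRC Y (semi X X) → DLRC Y X
  | A_L {X Y Z W} : DLRC (semi X (semi Y Z)) W → DLRC (semi (semi X Y) Z) W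
  | A_L' {X Y Z W} : DLRC (semi (semi X Y) Z) W → DLRC (semi X (semi Y Z)) W
  | A_R {X Y Z W} : DLRC W (semi (semi Z Y) X) → DLRC W (semi Z (semi Y X))
  | A_R' {X Y Z W} : DLRC W (semi Z (semi Y X)) → DLRC W (semi (semi Z Y) X)
  -- structural rules, pure resource type
  | Phi_L1 {Γ Δ} : DLRC (odot Γ Phi) Δ → DLRC Γ Δ
  | Phi_L1' {Γ Δ} : DLRC Γ Δ → DLRC (odot Γ Phi) Δ
  | Phi_L2 {Γ Δ} : DLRC Γ Δ → DLRC (odot Phi Γ) Δ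
  | Phi_L2' {Γ Δ} : DLRC (odot Phi Γ) Δ → DLRC Γ Δ
  | Phi_R {Γ Δ} : DLRC Γ Δ → DLRC Γ (comma Δ Phi)
  | Phi_R' {Γ Δ} : DLRC Γ (comma Δ Phi) → DLRC Γ Δ
  | odot_A_L {Γ Δ Θ Ξ} : DLRC (odot Γ (odot Δ Θ)) Ξ → DLRC (odot (odot Γ Δ) Θ) Ξ
  | odot_A_L' {Γ Δ Θ Ξ} : DLRC (odot (odot Γ Δ) Θ) Ξ → DLRC (odot Γ (odot Δ Θ)) Ξ
  | W_Phi {Γ Δ} : DLRC Phi Δ → DLRC Γ Δ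
  | comma_W_L {Γ Δ Θ} : DLRC Γ Δ → DLRC (comma Γ Θ) Δ
  | comma_W_R {Γ Δ Θ} : DLRC Γ Δ → DLRC Γ (comma Δ Θ)
  | comma_C_L {Γ Δ} : DLRC (comma Γ Γ) Δ → DLRC Γ Δ
  | comma_C_R {Γ Δ} : DLRC Γ (comma Δ Δ) → DLRC Γ Δ
  | comma_E_L {Γ Δ Θ} : DLRC (comma Γ Δ) Θ → DLRC (comma Δ Γ) Θ
  | comma_E_R {Γ Δ Θ} : DLRC Θ (comma Γ Δ) → DLRC Θ (comma Δ Γ)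
  | comma_A_L {Γ Δ Θ Ξ} : DLRC (comma Θ (comma Δ Γ)) Ξ → DLRC (comma (comma Θ Δ) Γ) Ξ
  | comma_A_L' {Γ Δ Θ Ξ} : DLRC (comma (comma Θ Δ) Γ) Ξ → DLRC (comma Θ (comma Δ Γ)) Ξ
  | comma_A_R {Γ Δ Θ Ξ} : DLRC Ξ (comma Θ (comma Δ Γ)) → DLRC Ξ (comma (comma Θ Δ) Γ)
  | comma_A_R' {Γ Δ Θ Ξ} : DLRC Ξ (comma (comma Θ Δ) Γ) → DLRC Ξ (comma Θ (comma Δ Γ))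
  | dis {Γ Δ Θ Ξ} :
      DLRC Ξ (comma (gtdot Γ Δ) (gtdot Γ Θ)) → DLRC Ξ (gtdot Γ (comma Δ Θ))
  -- structural rules of the D-axioms
  | D1 {X Y Z} : DLRC X (semi (bullet Y) (bullet Z)) → DLRC X (bullet (semi Y Z))
  | D2 {X} : DLRC X I → DLRC X (bullet I)
  | D3 {Γ X Y} :
      DLRC Γ (comma (bulletRes X) (bulletRes Y)) → DLRC Γ (bulletRes (semi X Y))
  | D4 {Γ} : DLRC Γ Phi → DLRC Γ (bulletRes I)
  -- structural rules of the B-axioms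
  | B1 {Γ Y Z W} : DLRC Γ (comma (btri Y W) (btri Z W)) → DLRC Γ (btri (semi Y Z) W)
  | B3 {X Γ Δ Y} : DLRC X (tri Γ (tri Δ Y)) → DLRC X (tri (odot Γ Δ) Y)
  | B4 {Γ Y Z Δ} :
      DLRC Γ (comma (btriRes Y Δ) (btriRes Z Δ)) → DLRC Γ (btriRes (semi Y Z) Δ)
  | B6 {Γ X Y Δ} : DLRC (comma (bup Γ X) (bup Γ Y)) Δ → DLRC (bup Γ (semi X Y)) Δ
  | B7 {Γ Δ} : DLRC Phi Δ → DLRC (bup Γ I) Δ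
  -- structural rules of the BD-axioms
  | BD1 {X Γ Y} : DLRC X (tri Γ (bullet Y)) → DLRC X (gt (circRes Γ) Y)
  | BD2 {X Γ Y} : DLRC X (triRes Γ (bulletRes Y)) → DLRC X (tri Γ Y)
  -- introduction rules, pure formula connectives
  | bot_L : DLRC (form .bot) I
  | bot_R {X} : DLRC X I → DLRC X (form .bot)
  | top_L {X} : DLRC I X → DLRC (form .top) X
  | top_R : DLRC I (form .top)
  | and_L {A B X} : DLRC (semi (form A) (form B)) X → DLRC (form (.and A B)) X
  | and_R {X Y A B} : DLRC X (form A) → DLRC Y (form B) → DLRC (semi X Y) (form (.and A B))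
  | or_L {A B X Y} : DLRC (form A) X → DLRC (form B) Y → DLRC (form (.or A B)) (semi X Y)
  | or_R {X A B} : DLRC X (semi (form A) (form B)) → DLRC X (form (.or A B))
  | imp_L {X Y A B} : DLRC X (form A) → DLRC (form B) Y → DLRC (form (.imp A B)) (gt X Y)
  | imp_R {X A B} : DLRC X (gt (form A) (form B)) → DLRC X (form (.imp A B))
  -- introduction rules, pure resource connectives
  | zero_L : DLRC (rterm .zero) Phi
  | zero_R {Γ} : DLRC Γ Phi → DLRC Γ (rterm .zero)
  | one_L {Γ} : DLRC Phi Γ → DLRC (rterm .one) Γ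
  | one_R : DLRC Phi (rterm .one)
  | dot_L {α β Γ} : DLRC (odot (rterm α) (rterm β)) Γ → DLRC (rterm (.dot α β)) Γ
  | dot_R {Γ Δ α β} :
      DLRC Γ (rterm α) → DLRC Δ (rterm β) → DLRC (odot Γ Δ) (rterm (.dot α β))
  | join_L {α β Γ Δ} :
      DLRC (rterm α) Γ → DLRC (rterm β) Δ → DLRC (rterm (.join α β)) (comma Γ Δ)
  | join_R {Γ α β} : DLRC Γ (comma (rterm α) (rterm β)) → DLRC Γ (rterm (.join α β))
  | meet_L {α β Γ} : DLRC (comma (rterm α) (rterm β)) Γ → DLRC (rterm (.meet α β)) Γ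
  | meet_R {Γ Δ α β} :
      DLRC Γ (rterm α) → DLRC Δ (rterm β) → DLRC (comma Γ Δ) (rterm (.meet α β))
  -- introduction rules, modal operators
  | able_L {A X} : DLRC (circ (form A)) X → DLRC (form (.able A)) X
  | able_R {A X} : DLRC X (form A) → DLRC (circ X) (form (.able A))
  | bring_L {Γ α A X} :
      DLRC Γ (rterm α) → DLRC (form A) X → DLRC (form (.bring α A)) (tri Γ X)
  | bring_R {X α A} : DLRC X (tri (rterm α) (form A)) → DLRC X (form (.bring α A))
  | has_L {α X} : DLRC (circRes (rterm α)) X → DLRC (form (.has α)) X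
  | has_R {Γ α} : DLRC Γ (rterm α) → DLRC (circRes Γ) (form (.has α))
  | get_L {Γ Δ α β} :
      DLRC Γ (rterm α) → DLRC (rterm β) Δ → DLRC (form (.get α β)) (triRes Γ Δ)
  | get_R {X α β} : DLRC X (triRes (rterm α) (rterm β)) → DLRC X (form (.get α β))

end LRC

/-! The proof is a soundness argument in the Lindenbaum–Tarski algebra of H.LRC: a Heyting algebra
of formulas and a bounded distributive lattice of resource terms, with the operations `·`, `◇`,
`◇ᵣ`, `▷`, `▷ᵣ`. This algebra need not contain values for the additional structural connectives of
D.LRC, such as co-implication and the adjoints of the modal operations. Instead of completing it,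
the proof interprets a structure by a filter in precedent position and by an ideal in succedent
position (`Str.sem`). In the language of canonical extensions these are the closed and the open
elements, and by compactness a closed element lies below an open one exactly when the filter meets
the ideal. Hence a sequent counts as valid when the filter of its left side meets the ideal of its
right side.

Each set is given by an existential condition on algebra elements, so most display rules only
permute existential quantifiers around one inequality. The axioms of H.LRC are used in two places:
to see that the sets are filters and ideals (`Str.isLatticeFilter_and_isLatticeIdeal`), and to
verify the remaining rules (`DLRC.meets`). A connective with no reading in its position gets the
whole algebra, which meets every filter and every ideal. Surgical cut is sound because replacing a
formula in succedent position by a structure with a larger ideal can only enlarge the set of the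
surrounding structure (`SucRepl.sem_subset`).

A formula is interpreted by its principal filter or principal ideal. Validity of `A ⊢ B` therefore
gives an element between the classes of `A` and `B`, so `A → B` is a theorem. -/

namespace LRC

/-! ### Filters and ideals of a distributive lattice, and their residuals. -/

section LatticeSets

variable {L : Type*}

/-- A subset of a bounded lattice is a (possibly improper) filter. -/
structure IsLatticeFilter [Lattice L] [BoundedOrder L] (S : Set L) : Prop where
  top_mem : ⊤ ∈ S
  mem_of_le : ∀ {a b}, a ≤ b → a ∈ S → b ∈ S
  inf_mem : ∀ {a b}, a ∈ S → b ∈ S → a ⊓ b ∈ S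

/-- A subset of a bounded lattice is a (possibly improper) ideal. -/
structure IsLatticeIdeal [Lattice L] [BoundedOrder L] (S : Set L) : Prop where
  bot_mem : ⊥ ∈ S
  mem_of_le : ∀ {a b}, a ≤ b → b ∈ S → a ∈ S
  sup_mem : ∀ {a b}, a ∈ S → b ∈ S → a ⊔ b ∈ S

/-- The composite of a ternary relation with two sets. -/
def relImage {M N : Type*} (R : M → N → L → Prop) (S : Set M) (T : Set N) : Set L :=
  {c | ∃ a ∈ S, ∃ b ∈ T, R a b c}

theorem relImage_mono {M N : Type*} {R : M → N → L → Prop} {S S' : Set M} {T T' : Set N}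
    (hS : S ⊆ S') (hT : T ⊆ T') : relImage R S T ⊆ relImage R S' T' :=
  fun _ ⟨a, ha, b, hb, h⟩ => ⟨a, hS ha, b, hT hb, h⟩

/-- The filter generated by two filters. -/
def filterInf [Lattice L] (S T : Set L) : Set L := relImage (fun a b c => a ⊓ b ≤ c) S T

/-- The ideal generated by two ideals. -/
def idealSup [Lattice L] (S T : Set L) : Set L := relImage (fun a b c => c ≤ a ⊔ b) S T

/-- The residual of `filterInf`: elements whose meet with the filter `S` falls into `T`. -/
def residual [Lattice L] (S T : Set L) : Set L := relImage (fun a b c => a ⊓ c ≤ b) S T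

/-- The residual of `idealSup`: elements whose join with the ideal `S` falls into `T`. -/
def coresidual [Lattice L] (S T : Set L) : Set L := relImage (fun a b c => b ≤ a ⊔ c) S T

section Lattice

variable [Lattice L] {F I J : Set L}

theorem filterInf_comm_subset (F G : Set L) : filterInf F G ⊆ filterInf G F :=
  fun _ ⟨a, ha, b, hb, h⟩ => ⟨b, hb, a, ha, (inf_comm b a).le.trans h⟩

theorem idealSup_comm_subset (I J : Set L) : idealSup I J ⊆ idealSup J I :=
  fun _ ⟨a, ha, b, hb, h⟩ => ⟨b, hb, a, ha, h.trans (sup_comm a b).le⟩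

theorem filterInf_assoc_subset (F G H : Set L) :
    filterInf F (filterInf G H) ⊆ filterInf (filterInf F G) H :=
  fun _ ⟨a, ha, _, ⟨b, hb, c, hc, h⟩, h'⟩ => ⟨a ⊓ b, ⟨a, ha, b, hb, le_rfl⟩, c, hc,
    (inf_assoc a b c).le.trans ((inf_le_inf_left a h).trans h')⟩

theorem filterInf_assoc_subset' (F G H : Set L) :
    filterInf (filterInf F G) H ⊆ filterInf F (filterInf G H) :=
  fun _ ⟨_, ⟨a, ha, b, hb, h⟩, c, hc, h'⟩ => ⟨a, ha, b ⊓ c, ⟨b, hb, c, hc, le_rfl⟩,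
    (inf_assoc a b c).ge.trans ((inf_le_inf_right c h).trans h')⟩

theorem idealSup_assoc_subset (I J K : Set L) :
    idealSup I (idealSup J K) ⊆ idealSup (idealSup I J) K :=
  fun _ ⟨a, ha, _, ⟨b, hb, c, hc, h⟩, h'⟩ => ⟨a ⊔ b, ⟨a, ha, b, hb, le_rfl⟩, c, hc,
    h'.trans ((sup_le_sup_left h a).trans (sup_assoc a b c).ge)⟩

theorem idealSup_assoc_subset' (I J K : Set L) :
    idealSup (idealSup I J) K ⊆ idealSup I (idealSup J K) :=
  fun _ ⟨_, ⟨a, ha, b, hb, h⟩, c, hc, h'⟩ => ⟨a, ha, b ⊔ c, ⟨b, hb, c, hc, le_rfl⟩,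
    h'.trans ((sup_le_sup_right h c).trans (sup_assoc a b c).le)⟩

/-- Both sides say that some `a ∈ I`, `b ∈ J`, `c ∈ F` satisfy `c ≤ a ⊔ b`. This is the display rule
for co-implication, without a co-implication in `L`. -/
theorem meets_idealSup_iff :
    (F ∩ idealSup I J).Nonempty ↔ (coresidual I F ∩ J).Nonempty :=
  ⟨fun ⟨c, hc, a, ha, b, hb, h⟩ => ⟨b, ⟨a, ha, c, hc, h⟩, hb⟩,
    fun ⟨b, ⟨a, ha, c, hc, h⟩, hb⟩ => ⟨c, hc, a, ha, b, hb, h⟩⟩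

end Lattice

section BoundedLattice

variable [DistribLattice L] [BoundedOrder L] {F G H I J K : Set L}

theorem IsLatticeFilter.univ : IsLatticeFilter (Set.univ : Set L) :=
  ⟨trivial, fun _ _ => trivial, fun _ _ => trivial⟩

theorem IsLatticeIdeal.univ : IsLatticeIdeal (Set.univ : Set L) :=
  ⟨trivial, fun _ _ => trivial, fun _ _ => trivial⟩

theorem isLatticeFilter_Ici (a : L) : IsLatticeFilter (Set.Ici a) :=
  ⟨Set.mem_Ici.2 le_top, fun h h' => le_trans h' h, fun h h' => le_inf h h'⟩

theorem isLatticeIdeal_Iic (a : L) : IsLatticeIdeal (Set.Iic a) :=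
  ⟨Set.mem_Iic.2 bot_le, fun h h' => le_trans h h', fun h h' => sup_le h h'⟩

theorem IsLatticeFilter.filterInf (hF : IsLatticeFilter F) (hG : IsLatticeFilter G) :
    IsLatticeFilter (filterInf F G) where
  top_mem := ⟨⊤, hF.top_mem, ⊤, hG.top_mem, le_top⟩
  mem_of_le := fun h ⟨a, ha, b, hb, h'⟩ => ⟨a, ha, b, hb, le_trans h' h⟩
  inf_mem := fun ⟨a, ha, b, hb, h⟩ ⟨a', ha', b', hb', h'⟩ =>
    ⟨a ⊓ a', hF.inf_mem ha ha', b ⊓ b', hG.inf_mem hb hb',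
      (inf_inf_inf_comm a a' b b').le.trans (inf_le_inf h h')⟩

theorem IsLatticeIdeal.idealSup (hI : IsLatticeIdeal I) (hJ : IsLatticeIdeal J) :
    IsLatticeIdeal (idealSup I J) where
  bot_mem := ⟨⊥, hI.bot_mem, ⊥, hJ.bot_mem, bot_le⟩
  mem_of_le := fun h ⟨a, ha, b, hb, h'⟩ => ⟨a, ha, b, hb, le_trans h h'⟩
  sup_mem := fun ⟨a, ha, b, hb, h⟩ ⟨a', ha', b', hb', h'⟩ =>
    ⟨a ⊔ a', hI.sup_mem ha ha', b ⊔ b', hJ.sup_mem hb hb',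
      (sup_le_sup h h').trans (sup_sup_sup_comm a b a' b').le⟩

/-- Closure under joins is where distributivity enters: the meet of the two witnesses from `F` and
the join of the two from `I` work for `c ⊔ c'`. -/
theorem IsLatticeFilter.residual (hF : IsLatticeFilter F) (hI : IsLatticeIdeal I) :
    IsLatticeIdeal (residual F I) where
  bot_mem := ⟨⊤, hF.top_mem, ⊥, hI.bot_mem, inf_le_right⟩
  mem_of_le := fun h ⟨a, ha, b, hb, h'⟩ => ⟨a, ha, b, hb, (inf_le_inf_left a h).trans h'⟩
  sup_mem := fun {c c'} ⟨a, ha, b, hb, h⟩ ⟨a', ha', b', hb', h'⟩ =>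
    ⟨a ⊓ a', hF.inf_mem ha ha', b ⊔ b', hI.sup_mem hb hb',
      (inf_sup_left (a ⊓ a') c c').le.trans (sup_le_sup
        ((inf_le_inf_right c inf_le_left).trans h) ((inf_le_inf_right c' inf_le_right).trans h'))⟩

theorem IsLatticeIdeal.coresidual (hI : IsLatticeIdeal I) (hF : IsLatticeFilter F) :
    IsLatticeFilter (coresidual I F) where
  top_mem := ⟨⊥, hI.bot_mem, ⊤, hF.top_mem, le_sup_right⟩
  mem_of_le := fun h ⟨a, ha, b, hb, h'⟩ => ⟨a, ha, b, hb, h'.trans (sup_le_sup_left h a)⟩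
  inf_mem := fun {c c'} ⟨a, ha, b, hb, h⟩ ⟨a', ha', b', hb', h'⟩ =>
    ⟨a ⊔ a', hI.sup_mem ha ha', b ⊓ b', hF.inf_mem hb hb',
      (inf_le_inf (h.trans (sup_le_sup_right le_sup_left c))
        (h'.trans (sup_le_sup_right le_sup_right c'))).trans (sup_inf_left (a ⊔ a') c c').ge⟩

theorem IsLatticeFilter.subset_filterInf_right (hF : IsLatticeFilter F) :
    G ⊆ LRC.filterInf F G :=
  fun a ha => ⟨⊤, hF.top_mem, a, ha, inf_le_right⟩

theorem IsLatticeIdeal.subset_idealSup_left (hJ : IsLatticeIdeal J) :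
    I ⊆ LRC.idealSup I J :=
  fun a ha => ⟨a, ha, ⊥, hJ.bot_mem, le_sup_left⟩

theorem IsLatticeFilter.filterInf_subset (hH : IsLatticeFilter H) (hF : F ⊆ H) (hG : G ⊆ H) :
    LRC.filterInf F G ⊆ H :=
  fun _ ⟨_, ha, _, hb, h⟩ => hH.mem_of_le h (hH.inf_mem (hF ha) (hG hb))

theorem IsLatticeIdeal.idealSup_subset (hK : IsLatticeIdeal K) (hI : I ⊆ K) (hJ : J ⊆ K) :
    LRC.idealSup I J ⊆ K :=
  fun _ ⟨_, ha, _, hb, h⟩ => hK.mem_of_le h (hK.sup_mem (hI ha) (hJ hb))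

theorem IsLatticeFilter.Ici_top_subset (hF : IsLatticeFilter F) : Set.Ici ⊤ ⊆ F :=
  fun _ h => hF.mem_of_le h hF.top_mem

theorem IsLatticeIdeal.Iic_bot_subset (hI : IsLatticeIdeal I) : Set.Iic ⊥ ⊆ I :=
  fun _ h => hI.mem_of_le h hI.bot_mem

/-- Both sides amount to `a ⊓ b ≤ c` for some `a ∈ F`, `b ∈ G`, `c ∈ I`: residuation at the level of
sets. -/
theorem IsLatticeIdeal.filterInf_meets_iff (hI : IsLatticeIdeal I) :
    (LRC.filterInf F G ∩ I).Nonempty ↔ (G ∩ LRC.residual F I).Nonempty :=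
  ⟨fun ⟨c, ⟨a, ha, b, hb, h⟩, hc⟩ => ⟨b, hb, a, ha, c, hc, h⟩,
    fun ⟨_, hb, _, ha, _, hc, h⟩ => ⟨_, ⟨_, ha, _, hb, le_rfl⟩, hI.mem_of_le h hc⟩⟩

end BoundedLattice

end LatticeSets

/-! ### The Lindenbaum–Tarski algebra of H.LRC -/

section Hilbert

variable {AtProp : Type u} {AtRes : Type v}

/-! ### Derived rules of intuitionistic logic. -/

namespace HThm

variable {A B C : Formula AtProp AtRes}

theorem imp_trans (h : HThm (.imp A B)) (h' : HThm (.imp B C)) : HThm (.imp A C) :=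
  .mp (.mp (.imp_s A B C) (.mp (.imp_k _ A) h')) h

theorem imp_refl (A : Formula AtProp AtRes) : HThm (.imp A A) :=
  .mp (.mp (.imp_s A (.imp A A) A) (.imp_k A (.imp A A))) (.imp_k A A)

theorem imp_and (h : HThm (.imp C A)) (h' : HThm (.imp C B)) : HThm (.imp C (.and A B)) :=
  .mp (.mp (.imp_s C B (.and A B)) (h.imp_trans (.and_intro A B))) h'

theorem or_imp (h : HThm (.imp A C)) (h' : HThm (.imp B C)) : HThm (.imp (.or A B) C) :=
  .mp (.mp (.or_elim A B C) h) h'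

theorem curry (h : HThm (.imp (.and A B) C)) : HThm (.imp A (.imp B C)) :=
  (HThm.and_intro A B).imp_trans (.mp (.imp_s B (.and A B) C) (.mp (.imp_k _ B) h))

theorem uncurry (h : HThm (.imp A (.imp B C))) : HThm (.imp (.and A B) C) :=
  .mp (.mp (.imp_s (.and A B) B C) ((HThm.and_left A B).imp_trans h)) (.and_right A B)

theorem iff_mp (h : HThm (.iff A B)) : HThm (.imp A B) := .mp (.and_left _ _) h

theorem iff_mpr (h : HThm (.iff A B)) : HThm (.imp B A) := .mp (.and_right _ _) h

theorem imp_of (h : HThm A) : HThm (.imp B A) := .mp (.imp_k A B) h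

end HThm

/-! ### The quotient algebras and their order. -/

variable (AtProp AtRes)

/-- Interderivability of formulas. -/
def fmSetoid : Setoid (Formula AtProp AtRes) where
  r A B := HThm (.imp A B) ∧ HThm (.imp B A)
  iseqv := ⟨fun A => ⟨.imp_refl A, .imp_refl A⟩, fun h => ⟨h.2, h.1⟩,
    fun h h' => ⟨h.1.imp_trans h'.1, h'.2.imp_trans h.2⟩⟩

/-- Interderivability of resource-terms, lifted to the universe of formulas. -/
def resSetoid : Setoid (ULift.{u} (ResTerm AtRes)) where
  r α β := ResEntails α.down β.down ∧ ResEntails β.down α.down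
  iseqv := ⟨fun _ => ⟨.refl _, .refl _⟩, fun h => ⟨h.2, h.1⟩,
    fun h h' => ⟨h.1.trans h'.1, h'.2.trans h.2⟩⟩

/-- Formulas up to interderivability. -/
def FmAlg : Type (max u v) := Quotient (fmSetoid AtProp AtRes)

/-- Resource-terms up to interderivability. -/
def ResAlg : Type (max u v) := Quotient (resSetoid.{u, v} AtRes)

variable {AtProp AtRes}

/-- The class of a formula. -/
def FmAlg.mk (A : Formula AtProp AtRes) : FmAlg AtProp AtRes := Quotient.mk _ A

/-- The class of a resource-term. -/
def ResAlg.mk (α : ResTerm AtRes) : ResAlg.{u, v} AtRes := Quotient.mk _ ⟨α⟩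

theorem FmAlg.ind {P : FmAlg AtProp AtRes → Prop} (h : ∀ A, P (mk A)) (x) : P x :=
  Quotient.ind h x

theorem ResAlg.ind {P : ResAlg.{u, v} AtRes → Prop} (h : ∀ α, P (mk α)) (x) : P x :=
  Quotient.ind (fun α => h α.down) x

instance : HeytingAlgebra (FmAlg AtProp AtRes) where
  le := Quotient.lift₂ (fun A B => HThm (.imp A B)) fun _ _ _ _ h h' => propext
    ⟨fun k => h.2.imp_trans (k.imp_trans h'.1), fun k => h.1.imp_trans (k.imp_trans h'.2)⟩
  le_refl := Quotient.ind HThm.imp_refl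
  le_trans := by
    rintro ⟨A⟩ ⟨B⟩ ⟨C⟩ h h'
    exact HThm.imp_trans h h'
  le_antisymm := by
    rintro ⟨A⟩ ⟨B⟩ h h'
    exact Quotient.sound ⟨h, h'⟩
  sup := Quotient.map₂ Formula.or fun _ _ h _ _ h' =>
    ⟨(h.1.imp_trans (.or_left _ _)).or_imp (h'.1.imp_trans (.or_right _ _)),
      (h.2.imp_trans (.or_left _ _)).or_imp (h'.2.imp_trans (.or_right _ _))⟩
  le_sup_left := by
    rintro ⟨A⟩ ⟨B⟩
    exact HThm.or_left A B
  le_sup_right := by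
    rintro ⟨A⟩ ⟨B⟩
    exact HThm.or_right A B
  sup_le := by
    rintro ⟨A⟩ ⟨B⟩ ⟨C⟩ h h'
    exact HThm.or_imp h h'
  inf := Quotient.map₂ Formula.and fun _ _ h _ _ h' =>
    ⟨((HThm.and_left _ _).imp_trans h.1).imp_and ((HThm.and_right _ _).imp_trans h'.1),
      ((HThm.and_left _ _).imp_trans h.2).imp_and ((HThm.and_right _ _).imp_trans h'.2)⟩
  inf_le_left := by
    rintro ⟨A⟩ ⟨B⟩
    exact HThm.and_left A B
  inf_le_right := by
    rintro ⟨A⟩ ⟨B⟩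
    exact HThm.and_right A B
  le_inf := by
    rintro ⟨A⟩ ⟨B⟩ ⟨C⟩ h h'
    exact HThm.imp_and h h'
  top := FmAlg.mk .top
  le_top := by
    rintro ⟨A⟩
    exact HThm.top_intro.imp_of
  -- Congruence is proved in curried form; `(HThm.imp_refl _).uncurry` is the evaluation map `(A →
  -- B) ∧ A → B`.
  himp := Quotient.map₂ Formula.imp fun _ _ h _ _ h' =>
    ⟨HThm.curry ((((HThm.and_left _ _).imp_and ((HThm.and_right _ _).imp_trans h.2)).imp_trans
        (HThm.imp_refl _).uncurry).imp_trans h'.1),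
      HThm.curry ((((HThm.and_left _ _).imp_and ((HThm.and_right _ _).imp_trans h.1)).imp_trans
        (HThm.imp_refl _).uncurry).imp_trans h'.2)⟩
  le_himp_iff := by
    rintro ⟨A⟩ ⟨B⟩ ⟨C⟩
    exact ⟨HThm.uncurry, HThm.curry⟩
  bot := FmAlg.mk .bot
  bot_le := by
    rintro ⟨A⟩
    exact HThm.bot_elim A
  compl := Quotient.map (fun A => Formula.imp A .bot) fun _ _ h =>
    ⟨HThm.curry (((HThm.and_left _ _).imp_and ((HThm.and_right _ _).imp_trans h.2)).imp_trans
        (HThm.imp_refl _).uncurry),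
      HThm.curry (((HThm.and_left _ _).imp_and ((HThm.and_right _ _).imp_trans h.1)).imp_trans
        (HThm.imp_refl _).uncurry)⟩
  himp_bot := by
    rintro ⟨A⟩
    rfl

/-- Resource terms have no implication, so the residuals of the comma will exist only as sets. -/
instance : DistribLattice (ResAlg.{u, v} AtRes) where
  le := Quotient.lift₂ (fun α β => ResEntails α.down β.down) fun _ _ _ _ h h' => propext
    ⟨fun k => h.2.trans (k.trans h'.1), fun k => h.1.trans (k.trans h'.2)⟩
  le_refl := Quotient.ind fun α => ResEntails.refl α.down
  le_trans := by
    rintro ⟨α⟩ ⟨β⟩ ⟨γ⟩ h h'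
    exact ResEntails.trans h h'
  le_antisymm := by
    rintro ⟨α⟩ ⟨β⟩ h h'
    exact Quotient.sound ⟨h, h'⟩
  sup := Quotient.map₂ (fun α β => ⟨.join α.down β.down⟩) fun _ _ h _ _ h' =>
    ⟨.join_least (h.1.trans (.join_left _ _)) (h'.1.trans (.join_right _ _)),
      .join_least (h.2.trans (.join_left _ _)) (h'.2.trans (.join_right _ _))⟩
  le_sup_left := by
    rintro ⟨α⟩ ⟨β⟩
    exact ResEntails.join_left _ _
  le_sup_right := by
    rintro ⟨α⟩ ⟨β⟩
    exact ResEntails.join_right _ _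
  sup_le := by
    rintro ⟨α⟩ ⟨β⟩ ⟨γ⟩ h h'
    exact ResEntails.join_least h h'
  inf := Quotient.map₂ (fun α β => ⟨.meet α.down β.down⟩) fun _ _ h _ _ h' =>
    ⟨.meet_greatest ((ResEntails.meet_left _ _).trans h.1)
        ((ResEntails.meet_right _ _).trans h'.1),
      .meet_greatest ((ResEntails.meet_left _ _).trans h.2)
        ((ResEntails.meet_right _ _).trans h'.2)⟩
  inf_le_left := by
    rintro ⟨α⟩ ⟨β⟩
    exact ResEntails.meet_left _ _
  inf_le_right := by
    rintro ⟨α⟩ ⟨β⟩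
    exact ResEntails.meet_right _ _
  le_inf := by
    rintro ⟨α⟩ ⟨β⟩ ⟨γ⟩ h h'
    exact ResEntails.meet_greatest h h'
  le_sup_inf := by
    rintro ⟨α⟩ ⟨β⟩ ⟨γ⟩
    exact ResEntails.join_meet _ _ _

instance : BoundedOrder (ResAlg.{u, v} AtRes) where
  top := ResAlg.mk .one
  le_top := by
    rintro ⟨α⟩
    exact ResEntails.le_one _
  bot := ResAlg.mk .zero
  bot_le := by
    rintro ⟨α⟩
    exact ResEntails.zero_le _

theorem FmAlg.mk_le_mk {A B : Formula AtProp AtRes} : mk A ≤ mk B ↔ HThm (.imp A B) := Iff.rfl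

/-! ### The modal and multiplicative operations on the quotients. -/

theorem ResEntails.dot_le_dot {α β γ δ : ResTerm AtRes} (h : ResEntails α β)
    (h' : ResEntails γ δ) : ResEntails (.dot α γ) (.dot β δ) :=
  (ResEntails.MF γ h).trans (.MF' β h')

theorem HThm.bring_imp {α β : ResTerm AtRes} {A B : Formula AtProp AtRes}
    (h : ResEntails β α) (h' : HThm (.imp A B)) : HThm (.imp (.bring α A) (.bring β B)) :=
  (HThm.AB A h).imp_trans (.MB β h')

theorem HThm.get_imp {α β γ δ : ResTerm AtRes} (h : ResEntails β α) (h' : ResEntails γ δ) :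
    HThm (.imp (.get α γ) (.get β δ) : Formula AtProp AtRes) :=
  (HThm.AB' γ h).imp_trans (.MB' β h')

/-- `·` on classes of resource-terms. -/
def ResAlg.dot : ResAlg.{u, v} AtRes → ResAlg.{u, v} AtRes → ResAlg.{u, v} AtRes :=
  Quotient.map₂ (fun α β => ⟨.dot α.down β.down⟩) fun _ _ h _ _ h' =>
    ⟨h.1.dot_le_dot h'.1, h.2.dot_le_dot h'.2⟩

/-- `◇` on classes of formulas. -/
def FmAlg.able : FmAlg AtProp AtRes → FmAlg AtProp AtRes :=
  Quotient.map Formula.able fun _ _ h => ⟨.MD h.1, .MD h.2⟩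

/-- `◇ᵣ` on classes of resource-terms. -/
def FmAlg.has : ResAlg.{u, v} AtRes → FmAlg AtProp AtRes :=
  Quotient.map (fun α => Formula.has α.down) fun _ _ h => ⟨.MD' h.1, .MD' h.2⟩

/-- `▷` on classes. -/
def FmAlg.bring : ResAlg.{u, v} AtRes → FmAlg AtProp AtRes → FmAlg AtProp AtRes :=
  Quotient.map₂ (fun α A => Formula.bring α.down A) fun _ _ h _ _ h' =>
    ⟨.bring_imp h.2 h'.1, .bring_imp h.1 h'.2⟩

/-- `▷ᵣ` on classes of resource-terms. -/
def FmAlg.get : ResAlg.{u, v} AtRes → ResAlg.{u, v} AtRes → FmAlg AtProp AtRes :=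
  Quotient.map₂ (fun α β => Formula.get α.down β.down) fun _ _ h _ _ h' =>
    ⟨.get_imp h.2 h'.1, .get_imp h.1 h'.2⟩

/-! ### The axioms of H.LRC as inequalities between classes. -/

namespace ResAlg

variable {x x' y y' z : ResAlg.{u, v} AtRes}

theorem dot_le_dot (h : x ≤ x') (h' : y ≤ y') : dot x y ≤ dot x' y' := by
  induction x using ind; induction x' using ind; induction y using ind; induction y' using ind
  exact ResEntails.dot_le_dot h h'

theorem dot_assoc (x y z : ResAlg.{u, v} AtRes) : dot (dot x y) z = dot x (dot y z) := by
  induction x using ind; induction y using ind; induction z using ind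
  exact Quotient.sound ⟨.dot_assoc' _ _ _, .dot_assoc _ _ _⟩

theorem dot_top (x : ResAlg.{u, v} AtRes) : dot x ⊤ = x := by
  induction x using ind
  exact Quotient.sound ⟨.dot_one _, .dot_one' _⟩

theorem top_dot (x : ResAlg.{u, v} AtRes) : dot ⊤ x = x := by
  induction x using ind
  exact Quotient.sound ⟨.one_dot _, .one_dot' _⟩

theorem dot_sup_le (x y z : ResAlg.{u, v} AtRes) : dot x (y ⊔ z) ≤ dot x y ⊔ dot x z := by
  induction x using ind; induction y using ind; induction z using ind
  exact ResEntails.dot_join _ _ _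

theorem sup_dot_le (x y z : ResAlg.{u, v} AtRes) : dot (y ⊔ z) x ≤ dot y x ⊔ dot z x := by
  induction x using ind; induction y using ind; induction z using ind
  exact ResEntails.join_dot _ _ _

/-- Annihilation is not an axiom; it follows because the unit `1` is also the top: `x · 0 ≤ 1 · 0 =
0`. It puts `⊥` into the residuals of `⊙`. -/
theorem dot_bot (x : ResAlg.{u, v} AtRes) : dot x ⊥ = ⊥ :=
  le_bot_iff.1 ((dot_le_dot le_top le_rfl).trans (top_dot ⊥).le)

theorem bot_dot (x : ResAlg.{u, v} AtRes) : dot ⊥ x = ⊥ :=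
  le_bot_iff.1 ((dot_le_dot le_rfl le_top).trans (dot_top ⊥).le)

end ResAlg

namespace FmAlg

variable {a b : FmAlg AtProp AtRes} {x x' y y' : ResAlg.{u, v} AtRes}

theorem inf_mk_imp_le {A B : Formula AtProp AtRes} (h : a ≤ mk A) (h' : mk B ≤ b) :
    a ⊓ mk (.imp A B) ≤ b :=
  ((inf_le_inf_right (mk A ⇨ mk B) h).trans inf_himp_le).trans h'

/-- Makes the residual of the principal filter of `A` and the principal ideal of `B` lie below the
class of `A → B`, as the right rule for `→` requires. -/
theorem le_mk_imp {A B : Formula AtProp AtRes} {c : FmAlg AtProp AtRes} (h : mk A ≤ a)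
    (h' : b ≤ mk B) (hc : a ⊓ c ≤ b) : c ≤ mk (.imp A B) :=
  show c ≤ mk A ⇨ mk B from le_himp_iff'.2 ((inf_le_inf_right c h).trans (hc.trans h'))

theorem able_mono (h : a ≤ b) : able a ≤ able b := by
  induction a using ind; induction b using ind
  exact HThm.MD h

/-- Of this equivalence axiom, as of the others below, only one half is needed; the opposite half is
a consequence of monotonicity or of the bounds. -/
theorem able_sup_le (a b : FmAlg AtProp AtRes) : able (a ⊔ b) ≤ able a ⊔ able b := by
  induction a using ind; induction b using ind
  exact (HThm.D1 _ _).iff_mp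

theorem able_bot_le : able (⊥ : FmAlg AtProp AtRes) ≤ ⊥ := HThm.D2.iff_mp

theorem has_mono (h : x ≤ y) : (has x : FmAlg AtProp AtRes) ≤ has y := by
  induction x using ResAlg.ind; induction y using ResAlg.ind
  exact HThm.MD' h

theorem has_sup_le (x y : ResAlg.{u, v} AtRes) :
    (has (x ⊔ y) : FmAlg AtProp AtRes) ≤ has x ⊔ has y := by
  induction x using ResAlg.ind; induction y using ResAlg.ind
  exact (HThm.D3 _ _).iff_mp

theorem has_bot_le : (has ⊥ : FmAlg AtProp AtRes) ≤ ⊥ := HThm.D4.iff_mp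

theorem bring_le_bring (h : x' ≤ x) (h' : a ≤ b) : bring x a ≤ bring x' b := by
  induction x using ResAlg.ind; induction x' using ResAlg.ind
  induction a using ind; induction b using ind
  exact HThm.bring_imp h h'

theorem le_bring_sup (x y : ResAlg.{u, v} AtRes) (a : FmAlg AtProp AtRes) :
    bring x a ⊓ bring y a ≤ bring (x ⊔ y) a := by
  induction x using ResAlg.ind; induction y using ResAlg.ind; induction a using ind
  exact (HThm.B1 _ _ _).iff_mpr

theorem le_bring_bot (a b : FmAlg AtProp AtRes) : a ≤ bring ⊥ b := by
  induction a using ind; induction b using ind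
  exact (HThm.B2 _).imp_of

theorem bring_bring_le (x y : ResAlg.{u, v} AtRes) (a : FmAlg AtProp AtRes) :
    bring x (bring y a) ≤ bring (ResAlg.dot x y) a := by
  induction x using ResAlg.ind; induction y using ResAlg.ind; induction a using ind
  exact HThm.B3 _ _ _

theorem get_le_get (h : x' ≤ x) (h' : y ≤ y') :
    (get x y : FmAlg AtProp AtRes) ≤ get x' y' := by
  induction x using ResAlg.ind; induction x' using ResAlg.ind
  induction y using ResAlg.ind; induction y' using ResAlg.ind
  exact HThm.get_imp h h'

theorem le_get_sup (x y z : ResAlg.{u, v} AtRes) :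
    (get x z ⊓ get y z : FmAlg AtProp AtRes) ≤ get (x ⊔ y) z := by
  induction x using ResAlg.ind; induction y using ResAlg.ind; induction z using ResAlg.ind
  exact (HThm.B4 _ _ _).iff_mpr

theorem le_get_bot (a : FmAlg AtProp AtRes) (x : ResAlg.{u, v} AtRes) : a ≤ get ⊥ x := by
  induction a using ind; induction x using ResAlg.ind
  exact (HThm.B5 _).imp_of

theorem le_get_inf (x y z : ResAlg.{u, v} AtRes) :
    (get x y ⊓ get x z : FmAlg AtProp AtRes) ≤ get x (y ⊓ z) := by
  induction x using ResAlg.ind; induction y using ResAlg.ind; induction z using ResAlg.ind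
  exact (HThm.B6 _ _ _).iff_mpr

theorem le_get_top (a : FmAlg AtProp AtRes) (x : ResAlg.{u, v} AtRes) : a ≤ get x ⊤ := by
  induction a using ind; induction x using ResAlg.ind
  exact (HThm.B7 _).imp_of

theorem has_inf_bring_le (x : ResAlg.{u, v} AtRes) (a : FmAlg AtProp AtRes) :
    has x ⊓ bring x a ≤ able a := by
  induction x using ResAlg.ind; induction a using ind
  exact HThm.BD1 _ _

theorem get_le_bring_has (x y : ResAlg.{u, v} AtRes) :
    (get x y : FmAlg AtProp AtRes) ≤ bring x (has y) := by
  induction x using ResAlg.ind; induction y using ResAlg.ind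
  exact HThm.BD2 _ _

end FmAlg

end Hilbert

/-! ### Structures as filters and ideals -/

section Structures

variable {AtProp : Type u} {AtRes : Type v}

variable (AtProp AtRes) in
/-- The Lindenbaum–Tarski algebra of the given type. -/
def Alg : Ty → Type (max u v)
  | .fm => FmAlg AtProp AtRes
  | .res => ResAlg.{u, v} AtRes

instance : ∀ τ, DistribLattice (Alg AtProp AtRes τ)
  | .fm => inferInstanceAs (DistribLattice (FmAlg AtProp AtRes))
  | .res => inferInstanceAs (DistribLattice (ResAlg.{u, v} AtRes))

instance : ∀ τ, BoundedOrder (Alg AtProp AtRes τ)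
  | .fm => inferInstanceAs (BoundedOrder (FmAlg AtProp AtRes))
  | .res => inferInstanceAs (BoundedOrder (ResAlg.{u, v} AtRes))

open FmAlg ResAlg in
/-- The set interpreting a structure: a filter of the Lindenbaum–Tarski algebra in precedent
position, an ideal in succedent position.  Structures whose main connective has no reading in
the given position are interpreted as the improper filter or ideal. -/
def Str.sem : {τ : Ty} → Str AtProp AtRes τ → Pos → Set (Alg AtProp AtRes τ)
  | _, .form A, .pre => Set.Ici (FmAlg.mk A)
  | _, .form A, .suc => Set.Iic (FmAlg.mk A)
  | _, .I, .pre => Set.Ici (⊤ : FmAlg AtProp AtRes)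
  | _, .I, .suc => Set.Iic (⊥ : FmAlg AtProp AtRes)
  | _, .semi X Y, .pre => filterInf (L := FmAlg AtProp AtRes) (X.sem .pre) (Y.sem .pre)
  | _, .semi X Y, .suc => idealSup (L := FmAlg AtProp AtRes) (X.sem .suc) (Y.sem .suc)
  | _, .gt X Y, .pre => coresidual (L := FmAlg AtProp AtRes) (X.sem .suc) (Y.sem .pre)
  | _, .gt X Y, .suc => residual (L := FmAlg AtProp AtRes) (X.sem .pre) (Y.sem .suc)
  | _, .lt X Y, .pre => coresidual (L := FmAlg AtProp AtRes) (Y.sem .suc) (X.sem .pre)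
  | _, .lt X Y, .suc => residual (L := FmAlg AtProp AtRes) (Y.sem .pre) (X.sem .suc)
  | _, .circ X, .pre => {b : FmAlg AtProp AtRes | ∃ a ∈ X.sem .pre, able a ≤ b}
  | _, .circ _, .suc => Set.univ
  | _, .circRes Γ, .pre => {b : FmAlg AtProp AtRes | ∃ x ∈ Γ.sem .pre, has x ≤ b}
  | _, .circRes _, .suc => Set.univ
  | _, .tri _ _, .pre => Set.univ
  -- The inequality `b ≤ x ▷ a` is read here as a condition on `b`; `btri` below reads the same
  -- inequality as a condition on `x`, so passing between them permutes quantifiers. The same holds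
  -- for `triRes`, `btriRes` and `bup`.
  | _, .tri Γ X, .suc =>
    relImage (fun x a (b : FmAlg AtProp AtRes) => b ≤ bring x a) (Γ.sem .pre) (X.sem .suc)
  | _, .triRes _ _, .pre => Set.univ
  | _, .triRes Γ Δ, .suc =>
    relImage (fun x y (b : FmAlg AtProp AtRes) => b ≤ get x y) (Γ.sem .pre) (Δ.sem .suc)
  | _, .bullet _, .pre => Set.univ
  -- The preimage under `◇` replaces a right adjoint, which need not exist in the algebra.
  | _, .bullet X, .suc => {a : FmAlg AtProp AtRes | able a ∈ X.sem .suc}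
  | _, .rterm α, .pre => Set.Ici (ResAlg.mk.{u, v} α)
  | _, .rterm α, .suc => Set.Iic (ResAlg.mk.{u, v} α)
  | _, .Phi, .pre => Set.Ici (⊤ : ResAlg.{u, v} AtRes)
  | _, .Phi, .suc => Set.Iic (⊥ : ResAlg.{u, v} AtRes)
  | _, .odot Γ Δ, .pre =>
    relImage (fun x y (z : ResAlg.{u, v} AtRes) => dot x y ≤ z) (Γ.sem .pre) (Δ.sem .pre)
  | _, .odot _ _, .suc => Set.univ
  | _, .comma Γ Δ, .pre => filterInf (L := ResAlg.{u, v} AtRes) (Γ.sem .pre) (Δ.sem .pre)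
  | _, .comma Γ Δ, .suc => idealSup (L := ResAlg.{u, v} AtRes) (Γ.sem .suc) (Δ.sem .suc)
  | _, .gtdot _ _, .pre => Set.univ
  | _, .gtdot Γ Δ, .suc =>
    relImage (fun x z (y : ResAlg.{u, v} AtRes) => dot x y ≤ z) (Γ.sem .pre) (Δ.sem .suc)
  | _, .ltdot _ _, .pre => Set.univ
  | _, .ltdot Γ Δ, .suc =>
    relImage (fun z y (x : ResAlg.{u, v} AtRes) => dot x y ≤ z) (Γ.sem .suc) (Δ.sem .pre)
  | _, .sqsup Γ Δ, .pre => coresidual (L := ResAlg.{u, v} AtRes) (Γ.sem .suc) (Δ.sem .pre)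
  | _, .sqsup Γ Δ, .suc => residual (L := ResAlg.{u, v} AtRes) (Γ.sem .pre) (Δ.sem .suc)
  | _, .sqsub Γ Δ, .pre => coresidual (L := ResAlg.{u, v} AtRes) (Δ.sem .suc) (Γ.sem .pre)
  | _, .sqsub Γ Δ, .suc => residual (L := ResAlg.{u, v} AtRes) (Δ.sem .pre) (Γ.sem .suc)
  | _, .bulletRes _, .pre => Set.univ
  | _, .bulletRes X, .suc =>
    {x : ResAlg.{u, v} AtRes | (has x : FmAlg AtProp AtRes) ∈ X.sem .suc}
  | _, .btri _ _, .pre => Set.univ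
  | _, .btri X Y, .suc =>
    relImage (fun (a : FmAlg AtProp AtRes) b (x : ResAlg.{u, v} AtRes) => a ≤ bring x b)
      (X.sem .pre) (Y.sem .suc)
  | _, .btriRes _ _, .pre => Set.univ
  | _, .btriRes X Δ, .suc =>
    relImage (fun (a : FmAlg AtProp AtRes) y (x : ResAlg.{u, v} AtRes) => a ≤ get x y)
      (X.sem .pre) (Δ.sem .suc)
  | _, .bup Γ X, .pre =>
    relImage (fun x (a : FmAlg AtProp AtRes) (y : ResAlg.{u, v} AtRes) => a ≤ get x y)
      (Γ.sem .pre) (X.sem .pre)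
  | _, .bup _ _, .suc => Set.univ

open FmAlg ResAlg in
/-- Structures are interpreted by filters in precedent and by ideals in succedent position. -/
theorem Str.isLatticeFilter_and_isLatticeIdeal {τ : Ty} (S : Str AtProp AtRes τ) :
    IsLatticeFilter (S.sem .pre) ∧ IsLatticeIdeal (S.sem .suc) := by
  induction S with
  | form A =>
    exact ⟨isLatticeFilter_Ici (L := FmAlg AtProp AtRes) _,
      isLatticeIdeal_Iic (L := FmAlg AtProp AtRes) _⟩
  | I =>
    exact ⟨isLatticeFilter_Ici (L := FmAlg AtProp AtRes) _,
      isLatticeIdeal_Iic (L := FmAlg AtProp AtRes) _⟩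
  | semi X Y hX hY => exact ⟨hX.1.filterInf hY.1, hX.2.idealSup hY.2⟩
  | gt X Y hX hY => exact ⟨hX.2.coresidual hY.1, hX.1.residual hY.2⟩
  | lt X Y hX hY => exact ⟨hY.2.coresidual hX.1, hY.1.residual hX.2⟩
  | circ X hX =>
    refine ⟨⟨⟨⊤, hX.1.top_mem, le_top⟩, fun h ⟨a, ha, h'⟩ => ⟨a, ha, le_trans h' h⟩,
      fun ⟨a, ha, h⟩ ⟨b, hb, h'⟩ => ⟨a ⊓ b, hX.1.inf_mem ha hb,
        le_inf ((able_mono inf_le_left).trans h) ((able_mono inf_le_right).trans h')⟩⟩, .univ⟩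
  | circRes Γ hΓ =>
    refine ⟨⟨⟨⊤, hΓ.1.top_mem, le_top⟩, fun h ⟨a, ha, h'⟩ => ⟨a, ha, le_trans h' h⟩,
      fun ⟨a, ha, h⟩ ⟨b, hb, h'⟩ => ⟨a ⊓ b, hΓ.1.inf_mem ha hb,
        le_inf ((has_mono inf_le_left).trans h) ((has_mono inf_le_right).trans h')⟩⟩, .univ⟩
  -- Since `▷` is antitone in the resource and monotone in the formula, shrinking the resource and
  -- enlarging the formula gives a common bound.
  | tri Γ X hΓ hX =>
    refine ⟨.univ, ⟨⟨⊤, hΓ.1.top_mem, ⊥, hX.2.bot_mem, bot_le⟩,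
      fun h ⟨x, hx, a, ha, h'⟩ => ⟨x, hx, a, ha, le_trans h h'⟩,
      fun ⟨x, hx, a, ha, h⟩ ⟨y, hy, b, hb, h'⟩ => ⟨x ⊓ y, hΓ.1.inf_mem hx hy, a ⊔ b,
        hX.2.sup_mem ha hb, sup_le (h.trans (bring_le_bring inf_le_left le_sup_left))
          (h'.trans (bring_le_bring inf_le_right le_sup_right))⟩⟩⟩
  | triRes Γ Δ hΓ hΔ =>
    refine ⟨.univ, ⟨⟨⊤, hΓ.1.top_mem, ⊥, hΔ.2.bot_mem, bot_le⟩,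
      fun h ⟨x, hx, a, ha, h'⟩ => ⟨x, hx, a, ha, le_trans h h'⟩,
      fun ⟨x, hx, a, ha, h⟩ ⟨y, hy, b, hb, h'⟩ => ⟨x ⊓ y, hΓ.1.inf_mem hx hy, a ⊔ b,
        hΔ.2.sup_mem ha hb, sup_le (h.trans (get_le_get inf_le_left le_sup_left))
          (h'.trans (get_le_get inf_le_right le_sup_right))⟩⟩⟩
  -- The preimage is an ideal because `◇` preserves finite joins (axioms D1, D2).
  | bullet X hX =>
    exact ⟨.univ, ⟨hX.2.mem_of_le able_bot_le hX.2.bot_mem,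
      fun h h' => hX.2.mem_of_le (able_mono h) h',
      fun h h' => hX.2.mem_of_le (able_sup_le _ _) (hX.2.sup_mem h h')⟩⟩
  | rterm α =>
    exact ⟨isLatticeFilter_Ici (L := ResAlg.{u, v} AtRes) _,
      isLatticeIdeal_Iic (L := ResAlg.{u, v} AtRes) _⟩
  | Phi =>
    exact ⟨isLatticeFilter_Ici (L := ResAlg.{u, v} AtRes) _,
      isLatticeIdeal_Iic (L := ResAlg.{u, v} AtRes) _⟩
  | odot Γ Δ hΓ hΔ =>
    refine ⟨⟨⟨⊤, hΓ.1.top_mem, ⊤, hΔ.1.top_mem, le_top⟩,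
      fun h ⟨x, hx, y, hy, h'⟩ => ⟨x, hx, y, hy, le_trans h' h⟩,
      fun ⟨x, hx, y, hy, h⟩ ⟨x', hx', y', hy', h'⟩ => ⟨x ⊓ x', hΓ.1.inf_mem hx hx', y ⊓ y',
        hΔ.1.inf_mem hy hy', le_inf ((dot_le_dot inf_le_left inf_le_left).trans h)
          ((dot_le_dot inf_le_right inf_le_right).trans h')⟩⟩, .univ⟩
  | comma X Y hX hY => exact ⟨hX.1.filterInf hY.1, hX.2.idealSup hY.2⟩
  | gtdot Γ Δ hΓ hΔ =>
    refine ⟨.univ, ⟨⟨⊤, hΓ.1.top_mem, ⊥, hΔ.2.bot_mem, (dot_bot _).le⟩,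
      fun h ⟨x, hx, z, hz, h'⟩ => ⟨x, hx, z, hz, (dot_le_dot le_rfl h).trans h'⟩,
      fun ⟨x, hx, z, hz, h⟩ ⟨x', hx', z', hz', h'⟩ => ⟨x ⊓ x', hΓ.1.inf_mem hx hx', z ⊔ z',
        hΔ.2.sup_mem hz hz', (dot_sup_le _ _ _).trans
          (sup_le_sup ((dot_le_dot inf_le_left le_rfl).trans h)
            ((dot_le_dot inf_le_right le_rfl).trans h'))⟩⟩⟩
  | ltdot Γ Δ hΓ hΔ =>
    refine ⟨.univ, ⟨⟨⊥, hΓ.2.bot_mem, ⊤, hΔ.1.top_mem, (bot_dot _).le⟩,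
      fun h ⟨z, hz, y, hy, h'⟩ => ⟨z, hz, y, hy, (dot_le_dot h le_rfl).trans h'⟩,
      fun ⟨z, hz, y, hy, h⟩ ⟨z', hz', y', hy', h'⟩ => ⟨z ⊔ z', hΓ.2.sup_mem hz hz', y ⊓ y',
        hΔ.1.inf_mem hy hy', (sup_dot_le _ _ _).trans
          (sup_le_sup ((dot_le_dot le_rfl inf_le_left).trans h)
            ((dot_le_dot le_rfl inf_le_right).trans h'))⟩⟩⟩
  | sqsup X Y hX hY => exact ⟨hX.2.coresidual hY.1, hX.1.residual hY.2⟩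
  | sqsub X Y hX hY => exact ⟨hY.2.coresidual hX.1, hY.1.residual hX.2⟩
  | bulletRes X hX =>
    exact ⟨.univ, ⟨hX.2.mem_of_le has_bot_le hX.2.bot_mem,
      fun h h' => hX.2.mem_of_le (has_mono h) h',
      fun h h' => hX.2.mem_of_le (has_sup_le _ _) (hX.2.sup_mem h h')⟩⟩
  -- As a set of resources, this is an ideal because `▷` turns finite joins in its first coordinate
  -- into meets (B1, B2).
  | btri X Y hX hY =>
    refine ⟨.univ, ⟨⟨⊤, hX.1.top_mem, ⊥, hY.2.bot_mem, le_bring_bot _ _⟩,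
      fun h ⟨a, ha, b, hb, h'⟩ => ⟨a, ha, b, hb, h'.trans (bring_le_bring h le_rfl)⟩,
      fun ⟨a, ha, b, hb, h⟩ ⟨a', ha', b', hb', h'⟩ => ⟨a ⊓ a', hX.1.inf_mem ha ha', b ⊔ b',
        hY.2.sup_mem hb hb', le_trans (inf_le_inf (h.trans (bring_le_bring le_rfl le_sup_left))
          (h'.trans (bring_le_bring le_rfl le_sup_right))) (le_bring_sup _ _ _)⟩⟩⟩
  | btriRes X Δ hX hΔ =>
    refine ⟨.univ, ⟨⟨⊤, hX.1.top_mem, ⊥, hΔ.2.bot_mem, le_get_bot _ _⟩,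
      fun h ⟨a, ha, b, hb, h'⟩ => ⟨a, ha, b, hb, h'.trans (get_le_get h le_rfl)⟩,
      fun ⟨a, ha, b, hb, h⟩ ⟨a', ha', b', hb', h'⟩ => ⟨a ⊓ a', hX.1.inf_mem ha ha', b ⊔ b',
        hΔ.2.sup_mem hb hb', le_trans (inf_le_inf (h.trans (get_le_get le_rfl le_sup_left))
          (h'.trans (get_le_get le_rfl le_sup_right))) (le_get_sup _ _ _)⟩⟩⟩
  -- Closure under meets is B6 and membership of `⊤` is B7.
  | bup Γ X hΓ hX =>
    refine ⟨⟨⟨⊤, hΓ.1.top_mem, ⊤, hX.1.top_mem, le_get_top _ _⟩,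
      fun h ⟨x, hx, a, ha, h'⟩ => ⟨x, hx, a, ha, h'.trans (get_le_get le_rfl h)⟩,
      fun ⟨x, hx, a, ha, h⟩ ⟨x', hx', a', ha', h'⟩ => ⟨x ⊓ x', hΓ.1.inf_mem hx hx', a ⊓ a',
        hX.1.inf_mem ha ha', le_trans (inf_le_inf (h.trans (get_le_get inf_le_left le_rfl))
          (h'.trans (get_le_get inf_le_right le_rfl))) (le_get_inf _ _ _)⟩⟩, .univ⟩

theorem Str.isLatticeFilter_sem {τ : Ty} (S : Str AtProp AtRes τ) :
    IsLatticeFilter (S.sem .pre) := S.isLatticeFilter_and_isLatticeIdeal.1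

theorem Str.isLatticeIdeal_sem {τ : Ty} (S : Str AtProp AtRes τ) :
    IsLatticeIdeal (S.sem .suc) := S.isLatticeFilter_and_isLatticeIdeal.2

/-! ### Surgical cut. -/

/-- As operations on sets, all connectives are monotone in every coordinate: a reversed position
shows up as a switch between filter and ideal, not as a reversed inclusion. -/
theorem SucRepl.sem_subset {A : Formula AtProp AtRes} {Z : Str AtProp AtRes .fm}
    (hA : (Str.form A).sem .suc ⊆ Z.sem .suc) {s : Pos} {τ : Ty} {S S' : Str AtProp AtRes τ}
    (h : SucRepl A Z s S S') : S.sem s ⊆ S'.sem s := by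
  induction h with
  | here => exact hA
  | @circ s _ _ _ ih =>
    cases s
    · exact fun _ ⟨a, ha, h⟩ => ⟨a, ih ha, h⟩
    · exact fun _ h => h
  | @circRes s _ _ _ ih =>
    cases s
    · exact fun _ ⟨a, ha, h⟩ => ⟨a, ih ha, h⟩
    · exact fun _ h => h
  | @bullet s _ _ _ ih =>
    cases s
    · exact fun _ h => h
    · exact fun _ h => ih h
  | @bulletRes s _ _ _ ih =>
    cases s
    · exact fun _ h => h
    · exact fun _ h => ih h
  | @semi_l s _ _ _ _ ih | @semi_r s _ _ _ _ ih | @gt_l s _ _ _ _ ih | @gt_r s _ _ _ _ ih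
  | @lt_l s _ _ _ _ ih | @lt_r s _ _ _ _ ih | @tri_l s _ _ _ _ ih | @tri_r s _ _ _ _ ih
  | @triRes_l s _ _ _ _ ih | @triRes_r s _ _ _ _ ih | @odot_l s _ _ _ _ ih
  | @odot_r s _ _ _ _ ih | @comma_l s _ _ _ _ ih | @comma_r s _ _ _ _ ih
  | @gtdot_l s _ _ _ _ ih | @gtdot_r s _ _ _ _ ih | @ltdot_l s _ _ _ _ ih
  | @ltdot_r s _ _ _ _ ih | @sqsup_l s _ _ _ _ ih | @sqsup_r s _ _ _ _ ih
  | @sqsub_l s _ _ _ _ ih | @sqsub_r s _ _ _ _ ih | @btri_l s _ _ _ _ ih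
  | @btri_r s _ _ _ _ ih | @btriRes_l s _ _ _ _ ih | @btriRes_r s _ _ _ _ ih
  | @bup_l s _ _ _ _ ih | @bup_r s _ _ _ _ ih =>
    -- Either the connective has no reading and both sets are improper, or one argument of
    -- `relImage` grows. Which argument it is can differ from the coordinate in the structure, as
    -- for `<` and `⊏`.
    cases s <;> first
      | exact subset_rfl
      | exact relImage_mono ih subset_rfl
      | exact relImage_mono subset_rfl ih

/-! ### Soundness of the rules of D.LRC. -/

open FmAlg ResAlg in
/-- Every derivable sequent is valid: the filter interpreting its precedent meets the ideal
interpreting its succedent. -/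
theorem DLRC.meets {τ : Ty} {S T : Str AtProp AtRes τ} (h : DLRC S T) :
    (S.sem .pre ∩ T.sem .suc).Nonempty := by
  have left {τ : Ty} {S S' T : Str AtProp AtRes τ} (ih : (S.sem .pre ∩ T.sem .suc).Nonempty)
      (h : S.sem .pre ⊆ S'.sem .pre) : (S'.sem .pre ∩ T.sem .suc).Nonempty :=
    ih.mono (Set.inter_subset_inter_left _ h)
  have right {τ : Ty} {S T T' : Str AtProp AtRes τ} (ih : (S.sem .pre ∩ T.sem .suc).Nonempty)
      (h : T.sem .suc ⊆ T'.sem .suc) : (S.sem .pre ∩ T'.sem .suc).Nonempty :=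
    ih.mono (Set.inter_subset_inter_right _ h)
  -- Validity of the cut premise `A ⊢ Z` puts the class of `A` into the ideal of `Z`, hence its
  -- whole principal ideal.
  have suc_subset {A : Formula AtProp AtRes} {Z : Str AtProp AtRes .fm}
      (ih : ((Str.form A).sem .pre ∩ Z.sem .suc).Nonempty) :
      (Str.form A).sem .suc ⊆ Z.sem .suc := by
    obtain ⟨c, hc, hc'⟩ := ih
    exact fun x hx => Z.isLatticeIdeal_sem.mem_of_le (le_trans (Set.mem_Iic.1 hx) hc) hc'
  induction h with
  | id_prop p => exact ⟨FmAlg.mk (.atom p), le_refl (FmAlg.mk _), le_refl (FmAlg.mk _)⟩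
  | id_res a => exact ⟨ResAlg.mk (.atom a), le_refl (ResAlg.mk _), le_refl (ResAlg.mk _)⟩
  | cut_fm_l _ r _ ih ih' => exact left ih (r.sem_subset (suc_subset ih'))
  | cut_fm_r _ r _ ih ih' => exact right ih (r.sem_subset (suc_subset ih'))
  | @cut_res Γ Δ α _ _ ih ih' =>
    obtain ⟨x, hx, h⟩ := ih
    obtain ⟨y, h', hy⟩ := ih'
    exact ⟨x, hx, Δ.isLatticeIdeal_sem.mem_of_le (le_trans h h') hy⟩
  | @semi_gt _ _ Z _ ih => exact Z.isLatticeIdeal_sem.filterInf_meets_iff.1 ih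
  | @semi_gt' _ _ Z _ ih => exact Z.isLatticeIdeal_sem.filterInf_meets_iff.2 ih
  | gt_semi _ ih => exact meets_idealSup_iff.1 ih
  | gt_semi' _ ih => exact meets_idealSup_iff.2 ih
  | @semi_lt _ _ Z _ ih =>
    exact Z.isLatticeIdeal_sem.filterInf_meets_iff.1
      (ih.mono (Set.inter_subset_inter_left _ (filterInf_comm_subset _ _)))
  | @semi_lt' _ _ Z _ ih =>
    exact (Z.isLatticeIdeal_sem.filterInf_meets_iff.2 ih).mono
      (Set.inter_subset_inter_left _ (filterInf_comm_subset _ _))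
  | lt_semi _ ih =>
    exact meets_idealSup_iff.1
      (ih.mono (Set.inter_subset_inter_right _ (idealSup_comm_subset _ _)))
  | lt_semi' _ ih =>
    exact (meets_idealSup_iff.2 ih).mono
      (Set.inter_subset_inter_right _ (idealSup_comm_subset _ _))
  | @comma_sqsup _ _ Z _ ih => exact Z.isLatticeIdeal_sem.filterInf_meets_iff.1 ih
  | @comma_sqsup' _ _ Z _ ih => exact Z.isLatticeIdeal_sem.filterInf_meets_iff.2 ih
  | sqsup_comma _ ih => exact meets_idealSup_iff.1 ih
  | sqsup_comma' _ ih => exact meets_idealSup_iff.2 ih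
  | @comma_sqsub _ _ Z _ ih =>
    exact Z.isLatticeIdeal_sem.filterInf_meets_iff.1
      (ih.mono (Set.inter_subset_inter_left _ (filterInf_comm_subset _ _)))
  | @comma_sqsub' _ _ Z _ ih =>
    exact (Z.isLatticeIdeal_sem.filterInf_meets_iff.2 ih).mono
      (Set.inter_subset_inter_left _ (filterInf_comm_subset _ _))
  | sqsub_comma _ ih =>
    exact meets_idealSup_iff.1
      (ih.mono (Set.inter_subset_inter_right _ (idealSup_comm_subset _ _)))
  | sqsub_comma' _ ih =>
    exact (meets_idealSup_iff.2 ih).mono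
      (Set.inter_subset_inter_right _ (idealSup_comm_subset _ _))
  | odot_gtdot _ ih =>
    obtain ⟨z, ⟨x, hx, y, hy, h⟩, hz⟩ := ih
    exact ⟨y, hy, x, hx, z, hz, h⟩
  | odot_gtdot' _ ih =>
    obtain ⟨y, hy, x, hx, z, hz, h⟩ := ih
    exact ⟨z, ⟨x, hx, y, hy, h⟩, hz⟩
  | odot_ltdot _ ih =>
    obtain ⟨z, ⟨x, hx, y, hy, h⟩, hz⟩ := ih
    exact ⟨x, hx, z, hz, y, hy, h⟩
  | odot_ltdot' _ ih =>
    obtain ⟨x, hx, z, hz, y, hy, h⟩ := ih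
    exact ⟨z, ⟨x, hx, y, hy, h⟩, hz⟩
  | @circ_bullet _ Y _ ih | @circRes_bulletRes _ Y _ ih =>
    obtain ⟨b, ⟨a, ha, h⟩, hb⟩ := ih
    exact ⟨a, ha, Y.isLatticeIdeal_sem.mem_of_le h hb⟩
  | circ_bullet' _ ih =>
    obtain ⟨a, ha, h⟩ := ih
    exact ⟨able a, ⟨a, ha, le_rfl⟩, h⟩
  | circRes_bulletRes' _ ih =>
    obtain ⟨a, ha, h⟩ := ih
    exact ⟨has a, ⟨a, ha, le_rfl⟩, h⟩
  | tri_btri _ ih | triRes_btriRes _ ih =>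
    obtain ⟨a, ha, x, hx, b, hb, h⟩ := ih
    exact ⟨x, hx, a, ha, b, hb, h⟩
  | tri_btri' _ ih | triRes_btriRes' _ ih =>
    obtain ⟨x, hx, a, ha, b, hb, h⟩ := ih
    exact ⟨a, ha, x, hx, b, hb, h⟩
  | triRes_bup _ ih =>
    obtain ⟨a, ha, x, hx, b, hb, h⟩ := ih
    exact ⟨b, ⟨x, hx, a, ha, h⟩, hb⟩
  | triRes_bup' _ ih =>
    obtain ⟨b, ⟨x, hx, a, ha, h⟩, hb⟩ := ih
    exact ⟨a, ha, x, hx, b, hb, h⟩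
  | I_L _ ih => exact left ih (Str.isLatticeFilter_sem .I).subset_filterInf_right
  | @I_L' X _ _ ih =>
    exact left ih (X.isLatticeFilter_sem.filterInf_subset
      X.isLatticeFilter_sem.Ici_top_subset subset_rfl)
  | I_R _ ih => exact right ih (Str.isLatticeIdeal_sem .I).subset_idealSup_left
  | @I_R' X _ _ ih =>
    exact right ih (X.isLatticeIdeal_sem.idealSup_subset
      subset_rfl X.isLatticeIdeal_sem.Iic_bot_subset)
  | E_L _ ih | comma_E_L _ ih => exact left ih (filterInf_comm_subset _ _)
  | E_R _ ih | comma_E_R _ ih => exact right ih (idealSup_comm_subset _ _)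
  | @W_L X _ _ _ ih => exact left ih X.isLatticeFilter_sem.subset_filterInf_right
  | @W_R X _ _ _ ih | @comma_W_R _ _ X _ ih =>
    exact right ih X.isLatticeIdeal_sem.subset_idealSup_left
  | @C_L X _ _ ih | @comma_C_L X _ _ ih =>
    exact left ih (X.isLatticeFilter_sem.filterInf_subset subset_rfl subset_rfl)
  | @C_R X _ _ ih | @comma_C_R _ X _ ih =>
    exact right ih (X.isLatticeIdeal_sem.idealSup_subset subset_rfl subset_rfl)
  | A_L _ ih | comma_A_L _ ih => exact left ih (filterInf_assoc_subset _ _ _)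
  | A_L' _ ih | comma_A_L' _ ih => exact left ih (filterInf_assoc_subset' _ _ _)
  | A_R' _ ih | comma_A_R _ ih => exact right ih (idealSup_assoc_subset _ _ _)
  | A_R _ ih | comma_A_R' _ ih => exact right ih (idealSup_assoc_subset' _ _ _)
  | @Phi_L1 Γ _ _ ih =>
    exact left ih fun _ ⟨x, hx, y, hy, h⟩ => Γ.isLatticeFilter_sem.mem_of_le
      (((dot_top x).ge.trans (dot_le_dot le_rfl hy)).trans h) hx
  | Phi_L1' _ ih =>
    exact left ih fun x hx => ⟨x, hx, ⊤, (Str.isLatticeFilter_sem .Phi).top_mem, (dot_top x).le⟩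
  | @Phi_L2' Γ _ _ ih =>
    exact left ih fun _ ⟨x, hx, y, hy, h⟩ => Γ.isLatticeFilter_sem.mem_of_le
      (((top_dot y).ge.trans (dot_le_dot hx le_rfl)).trans h) hy
  | Phi_L2 _ ih =>
    exact left ih fun x hx => ⟨⊤, (Str.isLatticeFilter_sem .Phi).top_mem, x, hx, (top_dot x).le⟩
  | Phi_R _ ih => exact right ih (Str.isLatticeIdeal_sem .Phi).subset_idealSup_left
  | @Phi_R' _ X _ ih =>
    exact right ih (X.isLatticeIdeal_sem.idealSup_subset
      subset_rfl X.isLatticeIdeal_sem.Iic_bot_subset)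
  | odot_A_L _ ih =>
    exact left ih fun _ ⟨x, hx, _, ⟨y, hy, z, hz, h⟩, h'⟩ => ⟨dot x y, ⟨x, hx, y, hy, le_rfl⟩,
      z, hz, (dot_assoc x y z).le.trans ((dot_le_dot le_rfl h).trans h')⟩
  | odot_A_L' _ ih =>
    exact left ih fun _ ⟨_, ⟨x, hx, y, hy, h⟩, z, hz, h'⟩ => ⟨x, hx, dot y z,
      ⟨y, hy, z, hz, le_rfl⟩, (dot_assoc x y z).ge.trans ((dot_le_dot h le_rfl).trans h')⟩
  | @W_Phi Γ _ _ ih => exact left ih Γ.isLatticeFilter_sem.Ici_top_subset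
  | @comma_W_L _ _ Θ _ ih =>
    exact left ih (Θ.isLatticeFilter_sem.subset_filterInf_right.trans (filterInf_comm_subset _ _))
  -- The two residuals come with different elements of `Γ`; their meet serves both. The rules B1, B4
  -- and B6 merge the witnesses of their shared structure in the same way.
  | @dis Γ _ _ _ _ ih =>
    exact right ih fun _ ⟨y, ⟨x, hx, z, hz, h⟩, y', ⟨x', hx', z', hz', h'⟩, h''⟩ =>
      ⟨x ⊓ x', Γ.isLatticeFilter_sem.inf_mem hx hx', z ⊔ z', ⟨z, hz, z', hz', le_rfl⟩,
        ((dot_le_dot le_rfl h'').trans (dot_sup_le _ _ _)).trans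
          (sup_le_sup ((dot_le_dot inf_le_left le_rfl).trans h)
            ((dot_le_dot inf_le_right le_rfl).trans h'))⟩
  | D1 _ ih =>
    exact right ih fun _ ⟨a, ha, b, hb, h⟩ => ⟨able a, ha, able b, hb,
      (able_mono h).trans (able_sup_le a b)⟩
  | D2 _ ih => exact right ih fun _ h => (able_mono h).trans able_bot_le
  | D3 _ ih =>
    exact right ih fun _ ⟨a, ha, b, hb, h⟩ => ⟨has a, ha, has b, hb,
      (has_mono h).trans (has_sup_le a b)⟩
  | D4 _ ih => exact right ih fun _ h => (has_mono h).trans has_bot_le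
  | @B1 _ _ _ W _ ih =>
    exact right ih fun _ ⟨x, ⟨a, ha, b, hb, h⟩, y, ⟨a', ha', b', hb', h'⟩, h''⟩ =>
      ⟨a ⊓ a', ⟨a, ha, a', ha', le_rfl⟩, b ⊔ b', W.isLatticeIdeal_sem.sup_mem hb hb',
        ((inf_le_inf (h.trans (bring_le_bring le_rfl le_sup_left))
          (h'.trans (bring_le_bring le_rfl le_sup_right))).trans (le_bring_sup x y _)).trans
            (bring_le_bring h'' le_rfl)⟩
  | B3 _ ih =>
    exact right ih fun _ ⟨x, hx, _, ⟨y, hy, b, hb, h⟩, h'⟩ => ⟨dot x y, ⟨x, hx, y, hy, le_rfl⟩,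
      b, hb, (h'.trans (bring_le_bring le_rfl h)).trans (bring_bring_le x y b)⟩
  | @B4 _ _ _ W _ ih =>
    exact right ih fun _ ⟨x, ⟨a, ha, b, hb, h⟩, y, ⟨a', ha', b', hb', h'⟩, h''⟩ =>
      ⟨a ⊓ a', ⟨a, ha, a', ha', le_rfl⟩, b ⊔ b', W.isLatticeIdeal_sem.sup_mem hb hb',
        ((inf_le_inf (h.trans (get_le_get le_rfl le_sup_left))
          (h'.trans (get_le_get le_rfl le_sup_right))).trans (le_get_sup x y _)).trans
            (get_le_get h'' le_rfl)⟩
  | @B6 Γ _ _ _ _ ih =>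
    exact left ih fun _ ⟨y, ⟨x, hx, a, ha, h⟩, y', ⟨x', hx', a', ha', h'⟩, h''⟩ =>
      ⟨x ⊓ x', Γ.isLatticeFilter_sem.inf_mem hx hx', a ⊓ a', ⟨a, ha, a', ha', le_rfl⟩,
        ((inf_le_inf (h.trans (get_le_get inf_le_left le_rfl))
          (h'.trans (get_le_get inf_le_right le_rfl))).trans (le_get_inf _ y y')).trans
            (get_le_get le_rfl h'')⟩
  -- The axiom `α ▷ᵣ 1` was already used to put `⊤` into this filter.
  | B7 _ ih => exact left ih (Str.isLatticeFilter_sem (.bup _ _)).Ici_top_subset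
  | BD1 _ ih =>
    exact right ih fun _ ⟨x, hx, a, ha, h⟩ => ⟨has x, ⟨x, hx, le_rfl⟩, able a, ha,
      (inf_le_inf le_rfl h).trans (has_inf_bring_le x a)⟩
  | BD2 _ ih =>
    exact right ih fun _ ⟨x, hx, y, hy, h⟩ => ⟨x, hx, has y, hy, h.trans (get_le_bring_has x y)⟩
  | bot_L => exact ⟨FmAlg.mk .bot, le_refl (FmAlg.mk _), le_refl (FmAlg.mk _)⟩
  -- The bounds of the algebras are by definition the classes of the constants, so premise and
  -- conclusion have the same interpretation.
  | bot_R _ ih | zero_R _ ih | top_L _ ih | one_L _ ih => exact ih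
  | top_R => exact ⟨FmAlg.mk .top, le_refl (FmAlg.mk _), le_refl (FmAlg.mk _)⟩
  | zero_L => exact ⟨ResAlg.mk .zero, le_refl (ResAlg.mk _), le_refl (ResAlg.mk _)⟩
  | one_R => exact ⟨ResAlg.mk .one, le_refl (ResAlg.mk _), le_refl (ResAlg.mk _)⟩
  | @and_L A B _ _ ih =>
    exact left ih fun c ⟨a, (ha : FmAlg.mk A ≤ a), b, (hb : FmAlg.mk B ≤ b), h⟩ =>
      show FmAlg.mk A ⊓ FmAlg.mk B ≤ c from (inf_le_inf ha hb).trans h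
  | @meet_L A B _ _ ih =>
    exact left ih fun c ⟨a, (ha : ResAlg.mk A ≤ a), b, (hb : ResAlg.mk B ≤ b), h⟩ =>
      show ResAlg.mk A ⊓ ResAlg.mk B ≤ c from (inf_le_inf ha hb).trans h
  | @or_R _ A B _ ih =>
    exact right ih fun c ⟨a, (ha : a ≤ FmAlg.mk A), b, (hb : b ≤ FmAlg.mk B), h⟩ =>
      show c ≤ FmAlg.mk A ⊔ FmAlg.mk B from le_trans h (sup_le_sup ha hb)
  | @join_R _ A B _ ih =>
    exact right ih fun c ⟨a, (ha : a ≤ ResAlg.mk A), b, (hb : b ≤ ResAlg.mk B), h⟩ =>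
      show c ≤ ResAlg.mk A ⊔ ResAlg.mk B from le_trans h (sup_le_sup ha hb)
  | @and_R _ _ A B _ _ ih ih' =>
    obtain ⟨a, ha, h : a ≤ FmAlg.mk A⟩ := ih
    obtain ⟨b, hb, h' : b ≤ FmAlg.mk B⟩ := ih'
    exact ⟨a ⊓ b, ⟨a, ha, b, hb, le_rfl⟩,
      show a ⊓ b ≤ FmAlg.mk A ⊓ FmAlg.mk B from inf_le_inf h h'⟩
  | @meet_R _ _ A B _ _ ih ih' =>
    obtain ⟨a, ha, h : a ≤ ResAlg.mk A⟩ := ih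
    obtain ⟨b, hb, h' : b ≤ ResAlg.mk B⟩ := ih'
    exact ⟨a ⊓ b, ⟨a, ha, b, hb, le_rfl⟩,
      show a ⊓ b ≤ ResAlg.mk A ⊓ ResAlg.mk B from inf_le_inf h h'⟩
  | @or_L A B _ _ _ _ ih ih' =>
    obtain ⟨a, h : FmAlg.mk A ≤ a, ha⟩ := ih
    obtain ⟨b, h' : FmAlg.mk B ≤ b, hb⟩ := ih'
    exact ⟨a ⊔ b, show FmAlg.mk A ⊔ FmAlg.mk B ≤ a ⊔ b from sup_le_sup h h',
      ⟨a, ha, b, hb, le_rfl⟩⟩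
  | @join_L A B _ _ _ _ ih ih' =>
    obtain ⟨a, h : ResAlg.mk A ≤ a, ha⟩ := ih
    obtain ⟨b, h' : ResAlg.mk B ≤ b, hb⟩ := ih'
    exact ⟨a ⊔ b, show ResAlg.mk A ⊔ ResAlg.mk B ≤ a ⊔ b from sup_le_sup h h',
      ⟨a, ha, b, hb, le_rfl⟩⟩
  | @imp_L _ _ A B _ _ ih ih' =>
    obtain ⟨a, ha, h : a ≤ FmAlg.mk A⟩ := ih
    obtain ⟨b, h' : FmAlg.mk B ≤ b, hb⟩ := ih'
    exact ⟨FmAlg.mk (.imp A B), le_refl (FmAlg.mk _), a, ha, b, hb,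
      inf_mk_imp_le h h'⟩
  | @imp_R _ A B _ ih =>
    exact right ih fun c ⟨a, (ha : FmAlg.mk A ≤ a), b, (hb : b ≤ FmAlg.mk B), h⟩ =>
      le_mk_imp ha hb h
  | @dot_L α β _ _ ih =>
    exact left ih fun z ⟨x, (hx : ResAlg.mk α ≤ x), y, (hy : ResAlg.mk β ≤ y), h⟩ =>
      show dot (ResAlg.mk α) (ResAlg.mk β) ≤ z from (dot_le_dot hx hy).trans h
  | @dot_R _ _ α β _ _ ih ih' =>
    obtain ⟨x, hx, h : x ≤ ResAlg.mk α⟩ := ih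
    obtain ⟨y, hy, h' : y ≤ ResAlg.mk β⟩ := ih'
    exact ⟨dot x y, ⟨x, hx, y, hy, le_rfl⟩,
      show dot x y ≤ dot (ResAlg.mk α) (ResAlg.mk β) from dot_le_dot h h'⟩
  | @able_L A _ _ ih =>
    exact left ih fun b ⟨a, (ha : FmAlg.mk A ≤ a), h⟩ =>
      show able (FmAlg.mk A) ≤ b from (able_mono ha).trans h
  | @able_R A _ _ ih =>
    obtain ⟨a, ha, h : a ≤ FmAlg.mk A⟩ := ih
    exact ⟨able a, ⟨a, ha, le_rfl⟩, show able a ≤ able (FmAlg.mk A) from able_mono h⟩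
  | @has_L α _ _ ih =>
    exact left ih fun b ⟨x, (hx : ResAlg.mk α ≤ x), h⟩ =>
      show has (ResAlg.mk α) ≤ b from (has_mono hx).trans h
  | @has_R _ α _ ih =>
    obtain ⟨x, hx, h : x ≤ ResAlg.mk α⟩ := ih
    exact ⟨has x, ⟨x, hx, le_rfl⟩, show has x ≤ has (ResAlg.mk α) from has_mono h⟩
  | @bring_L _ α A _ _ _ ih ih' =>
    obtain ⟨x, hx, h : x ≤ ResAlg.mk α⟩ := ih
    obtain ⟨a, h' : FmAlg.mk A ≤ a, ha⟩ := ih'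
    exact ⟨FmAlg.mk (.bring α A), le_refl (FmAlg.mk _), x, hx, a, ha,
      show bring (ResAlg.mk α) (FmAlg.mk A) ≤ bring x a from bring_le_bring h h'⟩
  | @bring_R _ α A _ ih =>
    exact right ih fun b ⟨x, (hx : ResAlg.mk α ≤ x), a, (ha : a ≤ FmAlg.mk A), h⟩ =>
      show b ≤ bring (ResAlg.mk α) (FmAlg.mk A) from h.trans (bring_le_bring hx ha)
  | @get_L _ _ α β _ _ ih ih' =>
    obtain ⟨x, hx, h : x ≤ ResAlg.mk α⟩ := ih
    obtain ⟨y, h' : ResAlg.mk β ≤ y, hy⟩ := ih'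
    exact ⟨FmAlg.mk (.get α β), le_refl (FmAlg.mk _), x, hx, y, hy,
      show FmAlg.get (ResAlg.mk α) (ResAlg.mk β) ≤ FmAlg.get x y from get_le_get h h'⟩
  | @get_R _ α β _ ih =>
    exact right ih fun b ⟨x, (hx : ResAlg.mk α ≤ x), y, (hy : y ≤ ResAlg.mk β), h⟩ =>
      show b ≤ FmAlg.get (ResAlg.mk α) (ResAlg.mk β) from h.trans (get_le_get hx hy)

end Structures

end LRC

theorem mainTheorem8 {AtProp : Type*} {AtRes : Type*}
    (A B : LRC.Formula AtProp AtRes)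
    (h : LRC.DLRC (LRC.Str.form A) (LRC.Str.form B)) :
    LRC.HEntails A B := by
  -- The common element `c` lies above the class of `A` and below that of `B`.
  obtain ⟨c, hA, hB⟩ := h.meets
  exact .mp (.thm (LRC.FmAlg.mk_le_mk.1 (le_trans (Set.mem_Ici.1 hA) (Set.mem_Iic.1 hB)))) .hyp
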